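/- Let $H\in(0,1)$, $\alpha\in(0,2)$ and $u<v$ be real numbers. Let $\widetilde M_\alpha$ be a complex-valued rotationally invariant $\alpha$-stable random measure on $\mathbb R$ with Lebesgue control measure, that is, a family of complex random variables $\widetilde M_\alpha(A)$, indexed by the Borel sets $A$ of finite Lebesgue measure $|A|$, which is independent over disjoint sets, almost surely $\sigma$-additive (along each sequence of pairwise disjoint sets whose union has finite measure), and satisfies $$\mathbb E\exp\big(i\,\mathrm{Re}(\overline z\,\widetilde M_\alpha(A))\big)=\exp\big(-|A|\,|z|^\alpha\big)\qquad(z\in\mathbb C).$$ For $f\in L^\alpha(\mathbb R;\mathbb C)$, the integral $\int_{\mathbb R} f\,d\widetilde M_\alpha$ is the limit in probability of the integrals $\sum_k c_k\widetilde M_\alpha(A_k)$ of simple functions $\sum_k c_k\mathbf 1_{A_k}$ (with disjoint Borel sets $A_k$ of finite measure) converging to $f$ in $L^\alpha$. Let $\{X(t),t\in\mathbb R\}$ be the harmonizable fractional stable motion, that is, the real-valued process with almost surely continuous paths such that, for each $t\in\mathbb R$, almost surely $$X(t)=\mathrm{Re}\bigg(\int_{\mathbb R}\frac{e^{it\xi}-1}{|\xi|^{H+1/\alpha}}\,d\widetilde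 M_\alpha(\xi)\bigg).$$ Then, almost surely, $$\sup_{u\le t'<t''\le v}\ \frac{|X(t')-X(t'')|}{|t'-t''|^{H}\,\big(\log(1+|t'-t''|^{-1})\big)^{1/\alpha}}=+\infty .$$ -/

import Mathlib

open MeasureTheory ProbabilityTheory Filter Topology

/-- `M` is a complex-valued rotationally invariant `α`-stable random measure on `ℝ` with Lebesgue
control measure, defined on the Borel sets of finite Lebesgue measure: it is independently
scattered, almost surely `σ`-additive along each disjoint sequence, and
`𝔼 exp (i Re (conj z * M A)) = exp (-|A| |z| ^ α)`.
(`charFun` is taken for the real inner product `Re (conj z * w)` of `ℂ`. The series in the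
`σ`-additivity is the limit of its partial sums, since it need not converge absolutely when
`1 ≤ α`.) -/
structure IsIsotropicStableRandomMeasure {Ω : Type*} [MeasurableSpace Ω] (P : Measure Ω)
    (α : ℝ) (M : Set ℝ → Ω → ℂ) : Prop where
  measurable : ∀ A : Set ℝ, MeasurableSet A → volume A < ⊤ → Measurable (M A)
  charFun_eq : ∀ A : Set ℝ, MeasurableSet A → volume A < ⊤ → ∀ z : ℂ,
    charFun (P.map (M A)) z = Complex.exp ((-((volume A).toReal * ‖z‖ ^ α) : ℝ) : ℂ)
  indep : ∀ A : ℕ → Set ℝ, (∀ n, MeasurableSet (A n)) → (∀ n, volume (A n) < ⊤) →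
    Pairwise (Function.onFun Disjoint A) → iIndepFun (fun n => M (A n)) P
  sigma_additive : ∀ A : ℕ → Set ℝ, (∀ n, MeasurableSet (A n)) → volume (⋃ n, A n) < ⊤ →
    Pairwise (Function.onFun Disjoint A) →
    ∀ᵐ ω ∂P, Tendsto (fun N : ℕ => ∑ n ∈ Finset.range N, M (A n) ω) atTop
      (𝓝 (M (⋃ n, A n) ω))

/-- The integral `∑ c, c * M {f = c}` of a simple function against a random measure. -/
noncomputable def simpleStochasticIntegral {Ω : Type*} (M : Set ℝ → Ω → ℂ)
    (f : SimpleFunc ℝ ℂ) (ω : Ω) : ℂ :=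
  ∑ c ∈ f.range, c * M (f ⁻¹' {c}) ω

/-- `Y` is (a version of) the stochastic integral `∫ f dM` of `f ∈ L^α(ℝ; ℂ)`: the limit in
probability of the integrals of simple functions, supported on sets of finite measure, that
converge to `f` in `L^α`. -/
def IsStochasticIntegral {Ω : Type*} [MeasurableSpace Ω] (P : Measure Ω)
    (α : ℝ) (M : Set ℝ → Ω → ℂ) (f : ℝ → ℂ) (Y : Ω → ℂ) : Prop :=
  MemLp f (ENNReal.ofReal α) volume ∧
  ∃ s : ℕ → SimpleFunc ℝ ℂ,
    (∀ n, (s n).FinMeasSupp volume) ∧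
    Tendsto (fun n => eLpNorm (fun ξ => s n ξ - f ξ) (ENNReal.ofReal α) volume) atTop (𝓝 0) ∧
    TendstoInMeasure P (fun n => simpleStochasticIntegral M (s n)) atTop Y

/-- The kernel `ξ ↦ (e^{itξ} - 1) / |ξ|^{H + 1/α}`. -/
noncomputable def hfsmKernel (H α t : ℝ) (ξ : ℝ) : ℂ :=
  (Complex.exp (Complex.I * t * ξ) - 1) / ((|ξ| ^ (H + 1 / α) : ℝ) : ℂ)

/-- `X` is the harmonizable fractional stable motion driven by `M`: a process with almost surely
continuous paths such that `X t = Re ∫ (e^{itξ} - 1) / |ξ|^{H + 1/α} dM(ξ)` almost surely,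
for each `t`. -/
structure IsHFSM {Ω : Type*} [MeasurableSpace Ω] (P : Measure Ω) (H α : ℝ)
    (M : Set ℝ → Ω → ℂ) (X : ℝ → Ω → ℝ) : Prop where
  randomMeasure : IsIsotropicStableRandomMeasure P α M
  integral_eq : ∀ t : ℝ, ∃ Y : Ω → ℂ,
    IsStochasticIntegral P α M (hfsmKernel H α t) Y ∧ ∀ᵐ ω ∂P, X t ω = (Y ω).re
  continuous_paths : ∀ᵐ ω ∂P, Continuous fun t => X t ω

/-!
The increments `X (u + 2⁻ʲ) - X u` are the real parts of integrals `∫ f j dM`. On the disjoint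
frequency bands `[2ʲ, 2ʲ⁺¹)` the kernel `f j` has `L^α` norm at least `κ 2^{-jH}`, so the
contributions `W j` of these bands are independent, and each has the law of a multiple, by at least
`κ 2^{-jH}`, of `Z = M [0, 1]`. Since `α < 2`, the characteristic function `exp (-|z|^α)` is too
rough at the origin for `E |Z|^α` to be finite; hence `∑ P (K b j < |W j|) = ∞` for every `K`, where
`b j` is a multiple of `2^{-jH} (log (1 + 2ʲ))^{1/α}`.

Rotating `W j` to `ζ W j` while leaving the rest of the increment and the other `W i` fixed does not
change their joint law. Among `m` such rotations of a large `W j`, at most two can bring the real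
part of the increment into `[-b j, b j]`, because a line parallel to the imaginary axis meets a
circle centred at the origin in at most two points. Conditioning on the first large `W j` bounds
the probability that all of the first `N` increments are small by `2 / m + ∏ P (|W j| ≤ K b j)`.
Let first `N` and then `m` tend to infinity.
-/

open scoped ENNReal ComplexConjugate Finset

lemma eq_or_eq_conj_of_norm_eq_of_re_eq {z w : ℂ} (hn : ‖z‖ = ‖w‖) (hre : z.re = w.re) :
    z = w ∨ z = conj w := by
  have him : z.im ^ 2 = w.im ^ 2 := by
    rw [← Complex.sq_norm_sub_sq_re, ← Complex.sq_norm_sub_sq_re, hn, hre]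
  rcases sq_eq_sq_iff_eq_or_eq_neg.1 him with h | h
  · exact .inl (Complex.ext hre h)
  · exact .inr (Complex.ext hre h)

lemma eq_zero_of_re_circle_mul_eq {x y z : Circle} (hxy : x ≠ y) (hxz : x ≠ z) (hyz : y ≠ z)
    {w : ℂ} (hx : (x * w).re = (z * w).re) (hy : (y * w).re = (z * w).re) : w = 0 := by
  have norm_eq (a b : Circle) : ‖a * w‖ = ‖b * w‖ := by
    rw [norm_mul, norm_mul, Circle.norm_coe, Circle.norm_coe]
  by_contra hw
  have cancel {a b : Circle} (h : (a : ℂ) * w = b * w) : a = b :=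
    Circle.coe_injective (mul_right_cancel₀ hw h)
  rcases eq_or_eq_conj_of_norm_eq_of_re_eq (norm_eq x z) hx with h | h
  · exact hxz (cancel h)
  rcases eq_or_eq_conj_of_norm_eq_of_re_eq (norm_eq y z) hy with h' | h'
  · exact hyz (cancel h')
  · exact hxy (cancel (h.trans h'.symm))

lemma eventually_forall_norm_le_of_abs_re_le {x y z : Circle} (hxy : x ≠ y) (hxz : x ≠ z)
    (hyz : y ≠ z) :
    ∀ᶠ K : ℝ in atTop, ∀ (w : ℂ) (r b : ℝ), |(x * w).re + r| ≤ b → |(y * w).re + r| ≤ b →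
      |(z * w).re + r| ≤ b → ‖w‖ ≤ K * b := by
  let L : ℂ →ₗ[ℝ] ℝ × ℝ :=
    (Complex.reLm ∘ₗ LinearMap.mulLeft ℝ (x - z : ℂ)).prod
      (Complex.reLm ∘ₗ LinearMap.mulLeft ℝ (y - z : ℂ))
  have hL (w : ℂ) : L w = ((x * w).re - (z * w).re, (y * w).re - (z * w).re) := by
    simp [L, sub_mul]
  have hker : LinearMap.ker L = ⊥ := LinearMap.ker_eq_bot'.2 fun w hw => by
    rw [hL, Prod.mk_eq_zero, sub_eq_zero, sub_eq_zero] at hw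
    exact eq_zero_of_re_circle_mul_eq hxy hxz hyz hw.1 hw.2
  obtain ⟨C, -, hC⟩ := L.exists_antilipschitzWith hker
  filter_upwards [eventually_ge_atTop (C * 2 : ℝ)] with K hK w r b hx hy hz
  have hb : 0 ≤ b := (abs_nonneg _).trans hx
  have sub_le {p q : ℝ} (hp : |p + r| ≤ b) (hq : |q + r| ≤ b) : ‖p - q‖ ≤ 2 * b := by
    rw [Real.norm_eq_abs]
    grind
  calc ‖w‖ ≤ C * ‖L w‖ := ZeroHomClass.bound_of_antilipschitz L hC w
    _ ≤ C * (2 * b) := by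
      gcongr
      rw [hL]
      exact max_le (sub_le hx hz) (sub_le hy hz)
    _ = C * 2 * b := (mul_assoc _ _ _).symm
    _ ≤ K * b := by gcongr

lemma exists_pos_forall_card_abs_re_le (S : Finset Circle) :
    ∃ K > 0, ∀ (w : ℂ) (r b : ℝ), K * b < ‖w‖ →
      #(S.filter fun ζ : Circle => |(ζ * w).re + r| ≤ b) ≤ 2 := by
  have key : ∀ᶠ K : ℝ in atTop, ∀ x ∈ S, ∀ y ∈ S, ∀ z ∈ S, x ≠ y → x ≠ z → y ≠ z →
      ∀ (w : ℂ) (r b : ℝ), |(x * w).re + r| ≤ b → |(y * w).re + r| ≤ b →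
        |(z * w).re + r| ≤ b → ‖w‖ ≤ K * b := by
    simp only [eventually_all_finset, eventually_imp_distrib_left]
    exact fun x _ y _ z _ hxy hxz hyz => eventually_forall_norm_le_of_abs_re_le hxy hxz hyz
  obtain ⟨K, hK, hK0⟩ := (key.and (eventually_gt_atTop 0)).exists
  refine ⟨K, hK0, fun w r b hw => ?_⟩
  contrapose! hw
  obtain ⟨x, y, z, hx, hy, hz, hxy, hxz, hyz⟩ := Finset.two_lt_card_iff.1 hw
  rw [Finset.mem_filter] at hx hy hz
  exact hK x hx.1 y hy.1 z hz.1 hxy hxz hyz w r b hx.2 hy.2 hz.2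

lemma exists_finset_circle_card_eq (m : ℕ) : ∃ S : Finset Circle, #S = m := by
  have : Infinite (Set.Ioc (-Real.pi) Real.pi) :=
    (Set.Ioc_infinite (neg_lt_self Real.pi_pos)).to_subtype
  have : Infinite Circle := Circle.argEquiv.infinite_iff.2 this
  exact Infinite.exists_subset_card_eq Circle m

section MeasureBounds

variable {X : Type*} [MeasurableSpace X] {μ : Measure X}

open scoped Classical in
lemma sum_measure_le_mul_of_card_le {ι : Type*} {S : Finset ι} {A : ι → Set X} {T : Set X}
    {k : ℕ} (hA : ∀ i ∈ S, MeasurableSet (A i)) (hAT : ∀ i ∈ S, A i ⊆ T)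
    (hcard : ∀ x ∈ T, #{i ∈ S | x ∈ A i} ≤ k) :
    ∑ i ∈ S, μ (A i) ≤ k * μ T := by
  have h (x : X) (hx : x ∈ T) : ∑ i ∈ S, (A i).indicator 1 x ≤ (k : ℝ≥0∞) := by
    simp only [Set.indicator_apply, Pi.one_apply, Finset.sum_boole]
    exact_mod_cast hcard x hx
  calc ∑ i ∈ S, μ (A i) = ∑ i ∈ S, μ.restrict T (A i) :=
        Finset.sum_congr rfl fun i hi => (Measure.restrict_eq_self _ (hAT i hi)).symm
    _ = ∑ i ∈ S, ∫⁻ x in T, (A i).indicator 1 x ∂μ :=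
        Finset.sum_congr rfl fun i hi => (lintegral_indicator_one (hA i hi)).symm
    _ = ∫⁻ x in T, ∑ i ∈ S, (A i).indicator 1 x ∂μ :=
        (lintegral_finsetSum' _ fun i hi => (measurable_one.indicator (hA i hi)).aemeasurable).symm
    _ ≤ ∫⁻ _ in T, k ∂μ := setLIntegral_mono measurable_const h
    _ = k * μ T := setLIntegral_const _ _

lemma measure_le_mul_add_measure_iInter_compl {ι : Type*} [LinearOrder ι]
    [LocallyFiniteOrderBot ι] [Countable ι] {A : Set X} {E : ι → Set X} {c : ℝ≥0∞}
    (hE : ∀ j, MeasurableSet (E j))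
    (hA : ∀ j, μ (A ∩ disjointed E j) ≤ c * μ (disjointed E j)) :
    μ A ≤ c * μ (⋃ j, E j) + μ (⋂ j, (E j)ᶜ) := by
  have hdisj (j : ι) : MeasurableSet (disjointed E j) :=
    disjointedRec (fun _ _ ht => ht.diff (hE _)) (hE j)
  calc μ A ≤ μ (A ∩ ⋃ j, E j) + μ (A \ ⋃ j, E j) := measure_le_inter_add_sdiff _ _ _
    _ ≤ c * μ (⋃ j, E j) + μ (⋂ j, (E j)ᶜ) := by
      gcongr
      · calc μ (A ∩ ⋃ j, E j) = μ (⋃ j, A ∩ disjointed E j) := by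
              rw [← iUnion_disjointed, Set.inter_iUnion]
          _ ≤ ∑' j, c * μ (disjointed E j) :=
              (measure_iUnion_le _).trans (ENNReal.tsum_le_tsum hA)
          _ = c * μ (⋃ j, E j) := by
              rw [ENNReal.tsum_mul_left, ← measure_iUnion (disjoint_disjointed E) hdisj,
                iUnion_disjointed]
      · rw [← Set.compl_iUnion]
        exact Set.inter_subset_right

open scoped Classical in
lemma card_mul_measure_inter_abs_re_le {S : Finset Circle} {τ : Circle → X → X} {T : Set X}
    {w : X → ℂ} {r : X → ℝ} {b : ℝ} {k : ℕ} (hτ : ∀ ζ ∈ S, MeasurePreserving (τ ζ) μ μ)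
    (hT : MeasurableSet T) (hw : Measurable w) (hr : Measurable r)
    (hτT : ∀ ζ ∈ S, τ ζ ⁻¹' T ⊆ T) (hτw : ∀ ζ ∈ S, ∀ x, w (τ ζ x) = ζ * w x)
    (hτr : ∀ ζ ∈ S, ∀ x, r (τ ζ x) = r x)
    (hcard : ∀ x ∈ T, #(S.filter fun ζ : Circle => |(ζ * w x).re + r x| ≤ b) ≤ k) :
    #S * μ (T ∩ {x | |(w x).re + r x| ≤ b}) ≤ k * μ T := by
  have hA : MeasurableSet (T ∩ {x | |(w x).re + r x| ≤ b}) :=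
    hT.inter (measurableSet_le (by fun_prop) measurable_const)
  calc #S * μ (T ∩ {x | |(w x).re + r x| ≤ b})
      = ∑ ζ ∈ S, μ (τ ζ ⁻¹' (T ∩ {x | |(w x).re + r x| ≤ b})) := by
        rw [Finset.sum_congr rfl fun ζ hζ => (hτ ζ hζ).measure_preimage hA.nullMeasurableSet,
          Finset.sum_const, nsmul_eq_mul]
    _ ≤ k * μ T := by
      refine sum_measure_le_mul_of_card_le (fun ζ hζ => (hτ ζ hζ).measurable hA)
        (fun ζ hζ x hx => hτT ζ hζ hx.1) fun x hx => (Finset.card_le_card ?_).trans (hcard x hx)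
      refine Finset.monotone_filter_right _ fun ζ hζ => ?_
      rintro ⟨-, h⟩
      rwa [Set.mem_ofPred_eq, hτw ζ hζ, hτr ζ hζ] at h

end MeasureBounds

lemma preimage_disjointed {X Y ι : Type*} [Preorder ι] [LocallyFiniteOrderBot ι] (g : X → Y)
    (f : ι → Set Y) (j : ι) :
    g ⁻¹' disjointed f j = disjointed (fun i => g ⁻¹' f i) j := by
  simp only [disjointed_eq_inter_compl, Set.preimage_inter, Set.preimage_iInter,
    Set.preimage_compl]

section FirstExceedance

variable {Ω : Type*} [MeasurableSpace Ω] {P : Measure Ω} {ι : Type*} [LinearOrder ι]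
  [LocallyFiniteOrderBot ι] {S : Finset Circle} {K : ℝ} {W : ι → Ω → ℂ}

open scoped Classical in
-- Rotating `W j` alone preserves the joint law, the remainder `R` and all the moduli, hence also
-- the event that `j` is the first exceedance.
lemma card_mul_measure_inter_disjointed_le
    (hK : ∀ (w : ℂ) (r b : ℝ), K * b < ‖w‖ →
      #(S.filter fun ζ : Circle => |(ζ * w).re + r| ≤ b) ≤ 2)
    (hW : ∀ i, Measurable (W i)) {R : Ω → ℂ} (hR : Measurable R) (b : ι → ℝ) {j : ι}
    (hrot : ∀ ζ ∈ S, MeasurePreserving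
      (fun y : Option ι → ℂ => Function.update y (some j) (ζ * y (some j)))
      (P.map fun ω o => o.elim (R ω) fun i => W i ω)
      (P.map fun ω o => o.elim (R ω) fun i => W i ω)) :
    #S * P ({ω | |(W j ω + R ω).re| ≤ b j} ∩ disjointed (fun i => {ω | K * b i < ‖W i ω‖}) j)
      ≤ 2 * P (disjointed (fun i => {ω | K * b i < ‖W i ω‖}) j) := by
  let V (ω : Ω) (o : Option ι) : ℂ := o.elim (R ω) fun i => W i ω
  have hV : Measurable V := measurable_pi_lambda _ fun o => by
    cases o
    exacts [hR, hW _]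
  let E (i : ι) : Set (Option ι → ℂ) := {y | K * b i < ‖y (some i)‖}
  let T : Set (Option ι → ℂ) := disjointed E j
  have hT : MeasurableSet T := disjointedRec
    (fun _ _ ht => ht.diff (measurableSet_lt measurable_const (by fun_prop)))
    (measurableSet_lt measurable_const (by fun_prop))
  have hVT : V ⁻¹' T = disjointed (fun i => {ω | K * b i < ‖W i ω‖}) j :=
    preimage_disjointed V _ j
  have hA : MeasurableSet {y : Option ι → ℂ | |(y (some j)).re + (y none).re| ≤ b j} :=
    measurableSet_le (by fun_prop) measurable_const
  have hVA : V ⁻¹' {y | |(y (some j)).re + (y none).re| ≤ b j}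
      = {ω | |(W j ω + R ω).re| ≤ b j} := rfl
  have norm_rot (ζ : Circle) (y : Option ι → ℂ) (i : ι) :
      ‖Function.update y (some j) (ζ * y (some j)) (some i)‖ = ‖y (some i)‖ := by
    by_cases hij : i = j
    · rw [hij, Function.update_self, norm_mul, Circle.norm_coe, one_mul]
    · rw [Function.update_of_ne (by simpa using hij)]
  have hrotT (ζ : Circle) :
      (fun y : Option ι → ℂ => Function.update y (some j) (ζ * y (some j))) ⁻¹' T = T := by
    simp only [T, E, preimage_disjointed, Set.preimage_ofPred_eq, norm_rot]
  have h := card_mul_measure_inter_abs_re_le (b := b j) hrot hT (w := fun y => y (some j))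
    (r := fun y => (y none).re) (by fun_prop) (by fun_prop) (fun ζ _ => (hrotT ζ).subset)
    (fun ζ _ y => Function.update_self _ _ _)
    (fun ζ _ y => by rw [Function.update_of_ne (Option.some_ne_none j).symm])
    (fun y hy => hK _ _ _ (disjointed_subset E j hy))
  rwa [Measure.map_apply hV hT, Measure.map_apply hV (hT.inter hA), Set.preimage_inter, hVT,
    hVA, Set.inter_comm] at h

open scoped Classical in
lemma measure_forall_abs_re_le_of_measurePreserving_update [IsProbabilityMeasure P]
    [Countable ι] (hS : S.Nonempty)
    (hK : ∀ (w : ℂ) (r b : ℝ), K * b < ‖w‖ →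
      #(S.filter fun ζ : Circle => |(ζ * w).re + r| ≤ b) ≤ 2)
    (hW : ∀ i, Measurable (W i)) {R : ι → Ω → ℂ} (hR : ∀ i, Measurable (R i)) (b : ι → ℝ)
    (hrot : ∀ j, ∀ ζ ∈ S, MeasurePreserving
      (fun y : Option ι → ℂ => Function.update y (some j) (ζ * y (some j)))
      (P.map fun ω o => o.elim (R j ω) fun i => W i ω)
      (P.map fun ω o => o.elim (R j ω) fun i => W i ω)) :
    P {ω | ∀ j, |(W j ω + R j ω).re| ≤ b j} ≤ 2 / #S + P {ω | ∀ i, ‖W i ω‖ ≤ K * b i} := by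
  let E (j : ι) : Set Ω := {ω | K * b j < ‖W j ω‖}
  have hE (j : ι) : MeasurableSet (E j) := measurableSet_lt measurable_const (hW j).norm
  have first_exceedance (j : ι) :
      P ({ω | ∀ j, |(W j ω + R j ω).re| ≤ b j} ∩ disjointed E j)
        ≤ 2 / #S * P (disjointed E j) := by
    have hsub : {ω | ∀ j, |(W j ω + R j ω).re| ≤ b j} ⊆ {ω | |(W j ω + R j ω).re| ≤ b j} :=
      fun ω hω => hω j
    refine (measure_mono (Set.inter_subset_inter_left _ hsub)).trans ?_
    rw [ENNReal.mul_comm_div, ← mul_div_assoc,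
      ENNReal.le_div_iff_mul_le (.inl (by simpa using hS.ne_empty)) (.inl (by simp)), mul_comm]
    exact card_mul_measure_inter_disjointed_le hK hW (hR j) b (hrot j)
  calc P {ω | ∀ j, |(W j ω + R j ω).re| ≤ b j}
      ≤ 2 / #S * P (⋃ j, E j) + P (⋂ j, (E j)ᶜ) :=
        measure_le_mul_add_measure_iInter_compl hE first_exceedance
    _ ≤ 2 / #S + P {ω | ∀ i, ‖W i ω‖ ≤ K * b i} := by
      gcongr
      · exact mul_le_of_le_one_right zero_le prob_le_one
      · intro ω hω
        simpa [E] using hω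

end FirstExceedance

lemma finMeasSupp_restrict {X E : Type*} [MeasurableSpace X] {μ : Measure X} [Zero E]
    {f : SimpleFunc X E} (hf : f.FinMeasSupp μ) {B : Set X} (hB : MeasurableSet B) :
    (f.restrict B).FinMeasSupp μ := by
  rw [SimpleFunc.finMeasSupp_iff_support, SimpleFunc.coe_restrict _ hB, Set.support_indicator]
  exact (measure_mono Set.inter_subset_right).trans_lt
    (SimpleFunc.finMeasSupp_iff_support.1 hf)

lemma finMeasSupp_smul {X 𝕜 E : Type*} [MeasurableSpace X] {μ : Measure X} [Zero E]
    [SMulZeroClass 𝕜 E] {f : SimpleFunc X E} (hf : f.FinMeasSupp μ) (c : 𝕜) :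
    (c • f).FinMeasSupp μ := by
  rw [SimpleFunc.smul_eq_map]
  exact hf.map (smul_zero c)

lemma finMeasSupp_sum {X E ι : Type*} [MeasurableSpace X] {μ : Measure X} [AddCommMonoid E]
    {s : Finset ι} {F : ι → SimpleFunc X E} (hF : ∀ i ∈ s, (F i).FinMeasSupp μ) :
    (∑ i ∈ s, F i).FinMeasSupp μ :=
  Finset.sum_induction F (fun f => f.FinMeasSupp μ) (fun _ _ hf hg => hf.add hg)
    (by simp [SimpleFunc.finMeasSupp_iff_support]) hF

lemma coe_simpleFunc_sum {X E ι : Type*} [MeasurableSpace X] [AddCommMonoid E] (s : Finset ι)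
    (F : ι → SimpleFunc X E) : ⇑(∑ i ∈ s, F i) = ∑ i ∈ s, ⇑(F i) :=
  map_sum (⟨⟨(⇑), rfl⟩, fun _ _ => rfl⟩ : SimpleFunc X E →+ X → E) F s

lemma simpleStochasticIntegral_zero {Ω : Type*} (M : Set ℝ → Ω → ℂ) (ω : Ω) :
    simpleStochasticIntegral M 0 ω = 0 := by
  refine Finset.sum_eq_zero fun c hc => ?_
  obtain ⟨x, rfl⟩ := SimpleFunc.mem_range.1 hc
  exact zero_mul _

namespace IsIsotropicStableRandomMeasure

variable {Ω : Type*} [MeasurableSpace Ω] {P : Measure Ω} {α : ℝ} {M : Set ℝ → Ω → ℂ}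

section FiniteAdditivity

lemma empty_ae (hM : IsIsotropicStableRandomMeasure P α M) : ∀ᵐ ω ∂P, M ∅ ω = 0 := by
  filter_upwards [hM.sigma_additive (fun _ => ∅) (by simp) (by simp)
    (fun _ _ _ => Set.disjoint_empty _)] with ω hω
  have h := ((tendsto_add_atTop_iff_nat 1).2 hω).sub hω
  simp only [Finset.sum_range_succ, add_sub_cancel_left, Set.iUnion_empty, sub_self] at h
  exact tendsto_nhds_unique tendsto_const_nhds h

lemma iUnion_ae (hM : IsIsotropicStableRandomMeasure P α M) {ι : Type*} [Fintype ι]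
    {A : ι → Set ℝ} (hA : ∀ i, MeasurableSet (A i)) (hAf : ∀ i, volume (A i) < ⊤)
    (hd : Pairwise (Function.onFun Disjoint A)) :
    ∀ᵐ ω ∂P, M (⋃ i, A i) ω = ∑ i, M (A i) ω := by
  have := Fintype.toEncodable ι
  have hmeas (n : ℕ) : MeasurableSet (⋃ i ∈ Encodable.decode₂ ι n, A i) :=
    Encodable.iUnion_decode₂_cases .empty hA
  filter_upwards [hM.empty_ae, hM.sigma_additive _ hmeas
    (by
      rw [Encodable.iUnion_decode₂ A, ← Set.biUnion_univ]
      exact measure_biUnion_lt_top Set.finite_univ fun i _ => hAf i)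
    (Encodable.iUnion_decode₂_disjoint_on hd)] with ω h0 hω
  rw [Encodable.iUnion_decode₂] at hω
  have hsum : HasSum (fun n => M (⋃ i ∈ Encodable.decode₂ ι n, A i) ω) (∑ i, M (A i) ω) := by
    refine ((Encodable.encode_injective (α := ι)).hasSum_iff fun n hn => ?_).1 ?_
    · have hempty : ⋃ i ∈ Encodable.decode₂ ι n, A i = ∅ := by
        simp only [Encodable.mem_decode₂, Set.iUnion_eq_empty]
        exact fun i hi => (hn ⟨i, hi⟩).elim
      rw [hempty, h0]
    · simpa [Function.comp_def] using hasSum_fintype fun i => M (A i) ω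
  exact tendsto_nhds_unique hω hsum.tendsto_sum_nat

lemma biUnion_finset_ae (hM : IsIsotropicStableRandomMeasure P α M) {ι : Type*} {s : Finset ι}
    {A : ι → Set ℝ} (hA : ∀ i ∈ s, MeasurableSet (A i)) (hAf : ∀ i ∈ s, volume (A i) < ⊤)
    (hd : (s : Set ι).PairwiseDisjoint A) :
    ∀ᵐ ω ∂P, M (⋃ i ∈ s, A i) ω = ∑ i ∈ s, M (A i) ω := by
  filter_upwards [hM.iUnion_ae (A := fun i : s => A i) (fun i => hA i i.2) (fun i => hAf i i.2)
    (hd.subtype)] with ω hω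
  rw [← Finset.sum_coe_sort, ← hω, Set.iUnion_subtype]

lemma iIndepFun_of_disjoint (hM : IsIsotropicStableRandomMeasure P α M) {ι : Type*} [Countable ι]
    {A : ι → Set ℝ} (hA : ∀ i, MeasurableSet (A i)) (hAf : ∀ i, volume (A i) < ⊤)
    (hd : Pairwise (Function.onFun Disjoint A)) :
    iIndepFun (fun i => M (A i)) P := by
  have := Encodable.ofCountable ι
  have hmeas (n : ℕ) : MeasurableSet (⋃ i ∈ Encodable.decode₂ ι n, A i) :=
    Encodable.iUnion_decode₂_cases .empty hA
  have hfinite (n : ℕ) : volume (⋃ i ∈ Encodable.decode₂ ι n, A i) < ⊤ :=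
    Encodable.iUnion_decode₂_cases (C := (volume · < ⊤)) (by simp) hAf
  simpa [Function.comp_def] using
    (hM.indep _ hmeas hfinite
      (Encodable.iUnion_decode₂_disjoint_on hd)).precomp
      (Encodable.encode_injective (α := ι))

end FiniteAdditivity

section SimpleIntegral

lemma integral_map_ae (hM : IsIsotropicStableRandomMeasure P α M) {E : Type*} [Zero E]
    {h : SimpleFunc ℝ E} (hh : h.FinMeasSupp volume) {g : E → ℂ} (hg : g 0 = 0) :
    ∀ᵐ ω ∂P, simpleStochasticIntegral M (h.map g) ω
      = ∑ p ∈ h.range, g p * M (h ⁻¹' {p}) ω := by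
  classical
  have fiber (c : ℂ) : ∀ᵐ ω ∂P, c * M ((h.map g) ⁻¹' {c}) ω
      = ∑ p ∈ h.range with g p = c, g p * M (h ⁻¹' {p}) ω := by
    have hsum (ω : Ω) : ∑ p ∈ h.range with g p = c, g p * M (h ⁻¹' {p}) ω
        = c * ∑ p ∈ h.range with g p = c, M (h ⁻¹' {p}) ω := by
      rw [Finset.mul_sum]
      exact Finset.sum_congr rfl fun p hp => by rw [(Finset.mem_filter.1 hp).2]
    simp only [hsum, mul_eq_mul_left_iff]
    by_cases hc : c = 0
    · exact .of_forall fun ω => .inr hc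
    have hne (p : E) (hp : p ∈ h.range.filter fun p => g p = c) : p ≠ 0 := by
      rintro rfl
      exact hc (by rw [← (Finset.mem_filter.1 hp).2, hg])
    filter_upwards [hM.biUnion_finset_ae (fun p _ => h.measurableSet_fiber p)
      (fun p hp => hh.meas_preimage_singleton_ne_zero (hne p hp))
      (fun p _ q _ hpq => Disjoint.preimage h (Set.disjoint_singleton.2 hpq))] with ω hω
    left
    rw [← hω, SimpleFunc.map_preimage_singleton]
    rw [← Set.biUnion_preimage_singleton]
    simp only [Finset.mem_coe]
  filter_upwards [(ae_ball_iff (Finset.countable_toSet _)).2 fun c _ => fiber c] with ω hω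
  rw [simpleStochasticIntegral, Finset.sum_congr rfl hω]
  refine Finset.sum_fiberwise_of_maps_to (fun p hp => ?_) _
  rw [SimpleFunc.range_map]
  exact Finset.mem_image_of_mem _ hp

lemma integral_add_ae (hM : IsIsotropicStableRandomMeasure P α M) {f g : SimpleFunc ℝ ℂ}
    (hf : f.FinMeasSupp volume) (hg : g.FinMeasSupp volume) :
    ∀ᵐ ω ∂P, simpleStochasticIntegral M (f + g) ω
      = simpleStochasticIntegral M f ω + simpleStochasticIntegral M g ω := by
  have hp : (f.pair g).FinMeasSupp volume := hf.pair hg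
  filter_upwards [hM.integral_map_ae hp (g := fun p => p.1 + p.2) (add_zero 0),
    hM.integral_map_ae hp (g := Prod.fst) rfl, hM.integral_map_ae hp (g := Prod.snd) rfl]
    with ω hadd hfst hsnd
  rw [SimpleFunc.map_fst_pair] at hfst
  rw [SimpleFunc.map_snd_pair] at hsnd
  rw [SimpleFunc.add_eq_map₂, hadd, hfst, hsnd, ← Finset.sum_add_distrib]
  simp only [add_mul]

lemma integral_smul_ae (hM : IsIsotropicStableRandomMeasure P α M) {f : SimpleFunc ℝ ℂ}
    (hf : f.FinMeasSupp volume) (c : ℂ) :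
    ∀ᵐ ω ∂P, simpleStochasticIntegral M (c • f) ω = c * simpleStochasticIntegral M f ω := by
  filter_upwards [hM.integral_map_ae hf (g := fun a => c • a) (smul_zero c)] with ω hω
  rw [SimpleFunc.smul_eq_map, hω, simpleStochasticIntegral, Finset.mul_sum]
  simp only [smul_eq_mul, mul_assoc]

lemma measurable_integral (hM : IsIsotropicStableRandomMeasure P α M) {f : SimpleFunc ℝ ℂ}
    (hf : f.FinMeasSupp volume) : Measurable (simpleStochasticIntegral M f) := by
  refine Finset.measurable_fun_sum _ fun c _ => ?_
  by_cases hc : c = 0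
  · simp [hc]
  · exact (hM.measurable _ (f.measurableSet_fiber c)
      (hf.meas_preimage_singleton_ne_zero hc)).const_mul c

lemma integral_sum_ae (hM : IsIsotropicStableRandomMeasure P α M) {ι : Type*} {s : Finset ι}
    {F : ι → SimpleFunc ℝ ℂ} (hF : ∀ i ∈ s, (F i).FinMeasSupp volume) :
    ∀ᵐ ω ∂P, simpleStochasticIntegral M (∑ i ∈ s, F i) ω
      = ∑ i ∈ s, simpleStochasticIntegral M (F i) ω := by
  classical
  induction s using Finset.induction_on with
  | empty => simp [simpleStochasticIntegral_zero]
  | insert a s ha ih =>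
    rw [Finset.forall_mem_insert] at hF
    simp only [Finset.sum_insert ha]
    filter_upwards [ih hF.2, hM.integral_add_ae hF.1 (finMeasSupp_sum hF.2)] with ω hs hadd
    rw [hadd, hs]

lemma integral_linearCombination_ae (hM : IsIsotropicStableRandomMeasure P α M) {ι : Type*}
    [Fintype ι] {F : ι → SimpleFunc ℝ ℂ} (hF : ∀ i, (F i).FinMeasSupp volume) (c : ι → ℂ) :
    ∀ᵐ ω ∂P, simpleStochasticIntegral M (∑ i, c i • F i) ω
      = ∑ i, c i * simpleStochasticIntegral M (F i) ω := by
  filter_upwards [hM.integral_sum_ae fun i (_ : i ∈ Finset.univ) => finMeasSupp_smul (hF i) (c i),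
    ae_all_iff.2 fun i => hM.integral_smul_ae (hF i) (c i)] with ω hsum hsmul
  rw [hsum, Finset.sum_congr rfl fun i _ => hsmul i]

end SimpleIntegral
end IsIsotropicStableRandomMeasure

lemma charFun_map_const_mul {Ω : Type*} [MeasurableSpace Ω] {P : Measure Ω} {Y : Ω → ℂ}
    (hY : AEMeasurable Y P) (c z : ℂ) :
    charFun (P.map fun ω => c * Y ω) z = charFun (P.map Y) (conj c * z) := by
  rw [charFun_apply, charFun_apply, integral_map (by fun_prop) (by fun_prop),
    integral_map hY (by fun_prop)]
  simp only [Complex.inner, map_mul]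
  refine integral_congr_ae (.of_forall fun ω => ?_)
  beta_reduce
  congr 4
  ring

section SimpleFuncNorm

variable {X : Type*} [MeasurableSpace X] {μ : Measure X} {α : ℝ} {E : Type*}
  [NormedAddCommGroup E]

lemma integrable_norm_rpow_of_finMeasSupp (hα : 0 < α) {f : SimpleFunc X E}
    (hf : f.FinMeasSupp μ) : Integrable (fun ξ => ‖f ξ‖ ^ α) μ :=
  SimpleFunc.integrable_iff_finMeasSupp.2
    (hf.map (g := fun c : E => ‖c‖ ^ α) (by simp [hα.ne']))

lemma integral_norm_rpow_eq_sum (hα : 0 < α) {f : SimpleFunc X E} (hf : f.FinMeasSupp μ) :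
    ∫ ξ, ‖f ξ‖ ^ α ∂μ = ∑ c ∈ f.range, μ.real (f ⁻¹' {c}) * ‖c‖ ^ α := by
  have h := SimpleFunc.map_integral f (fun c => ‖c‖ ^ α)
    (SimpleFunc.integrable_iff_finMeasSupp.2 hf) (by simp [hα.ne'])
  rw [SimpleFunc.integral_eq_integral _ (integrable_norm_rpow_of_finMeasSupp hα hf)] at h
  exact h

end SimpleFuncNorm

namespace IsIsotropicStableRandomMeasure

section CharFun

variable {Ω : Type*} [MeasurableSpace Ω] {P : Measure Ω} {α : ℝ} {M : Set ℝ → Ω → ℂ}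

lemma charFun_integral (hM : IsIsotropicStableRandomMeasure P α M) (hα : 0 < α)
    {f : SimpleFunc ℝ ℂ} (hf : f.FinMeasSupp volume) (z : ℂ) :
    charFun (P.map (simpleStochasticIntegral M f)) z
      = Complex.exp ((-((∫ ξ, ‖f ξ‖ ^ α) * ‖z‖ ^ α) : ℝ) : ℂ) := by
  classical
  let s := f.range.erase 0
  let A (c : s) : Set ℝ := f ⁻¹' {c.1}
  have hA (c : s) : MeasurableSet (A c) := f.measurableSet_fiber c.1
  have hAf (c : s) : volume (A c) < ⊤ :=
    hf.meas_preimage_singleton_ne_zero (Finset.ne_of_mem_erase c.2)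
  have hmeas (c : s) : Measurable (M (A c)) := hM.measurable _ (hA c) (hAf c)
  have hindep : iIndepFun (fun (c : s) ω => c.1 * M (A c) ω) P :=
    (hM.iIndepFun_of_disjoint hA hAf fun c d hcd => Disjoint.preimage f
      (Set.disjoint_singleton.2 (Subtype.coe_ne_coe.2 hcd))).comp _ fun c =>
        measurable_const_mul c.1
  have hsum : simpleStochasticIntegral M f = ∑ c : s, fun ω => c.1 * M (A c) ω := by
    ext ω
    rw [simpleStochasticIntegral, Finset.sum_apply,
      Finset.sum_coe_sort s fun c => c * M (f ⁻¹' {c}) ω]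
    exact (Finset.sum_erase _ (zero_mul _)).symm
  have hscale : ∫ ξ, ‖f ξ‖ ^ α = ∑ c : s, (volume (A c)).toReal * ‖c.1‖ ^ α := by
    rw [integral_norm_rpow_eq_sum hα hf,
      Finset.sum_coe_sort s fun c => (volume (f ⁻¹' {c})).toReal * ‖c‖ ^ α]
    exact (Finset.sum_erase _ (by simp [hα.ne'])).symm
  rw [hsum, hindep.charFun_map_sum_eq_prod fun c => ((hmeas c).const_mul _).aemeasurable,
    Finset.prod_apply]
  simp_rw [charFun_map_const_mul (hmeas _).aemeasurable, hM.charFun_eq _ (hA _) (hAf _)]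
  rw [← Complex.exp_sum, ← Complex.ofReal_sum, hscale, Finset.sum_mul, Finset.sum_neg_distrib]
  simp only [norm_mul, RCLike.norm_conj, Real.mul_rpow (norm_nonneg _) (norm_nonneg _), mul_assoc]

lemma measurable_toLp_integral (hM : IsIsotropicStableRandomMeasure P α M) {ι : Type*}
    {F : ι → SimpleFunc ℝ ℂ} (hF : ∀ i, (F i).FinMeasSupp volume) :
    Measurable fun ω => WithLp.toLp 2 fun i => simpleStochasticIntegral M (F i) ω :=
  (WithLp.measurable_toLp 2 _).comp (measurable_pi_lambda _ fun i => hM.measurable_integral (hF i))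

lemma charFun_toLp_integral (hM : IsIsotropicStableRandomMeasure P α M) (hα : 0 < α)
    {ι : Type*} [Fintype ι] {F : ι → SimpleFunc ℝ ℂ} (hF : ∀ i, (F i).FinMeasSupp volume)
    (z : EuclideanSpace ℂ ι) :
    charFun (P.map fun ω => WithLp.toLp 2 fun i => simpleStochasticIntegral M (F i) ω) z
      = Complex.exp ((-∫ ξ, ‖∑ i, conj (z i) * F i ξ‖ ^ α : ℝ) : ℂ) := by
  have hcomb : (∑ i, conj (z i) • F i).FinMeasSupp volume :=
    finMeasSupp_sum fun i _ => finMeasSupp_smul (hF i) _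
  have h := hM.charFun_integral hα hcomb 1
  simp only [coe_simpleFunc_sum, SimpleFunc.coe_smul, Finset.sum_apply, Pi.smul_apply, smul_eq_mul,
    norm_one, Real.one_rpow, mul_one] at h
  rw [← h, charFun_apply, charFun_apply,
    integral_map (hM.measurable_toLp_integral hF).aemeasurable (by fun_prop),
    integral_map (hM.measurable_integral hcomb).aemeasurable (by fun_prop)]
  refine integral_congr_ae ?_
  filter_upwards [hM.integral_linearCombination_ae hF fun i => conj (z i)] with ω hω
  rw [hω, PiLp.inner_apply, sum_inner]
  congr 3
  refine Finset.sum_congr rfl fun i _ => ?_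
  simp only [Complex.inner, map_mul, Complex.conj_conj]
  rw [one_mul, mul_comm]

lemma map_integral_congr (hM : IsIsotropicStableRandomMeasure P α M)
    [IsProbabilityMeasure P] (hα : 0 < α) {ι : Type*} [Fintype ι] {F G : ι → SimpleFunc ℝ ℂ}
    (hF : ∀ i, (F i).FinMeasSupp volume) (hG : ∀ i, (G i).FinMeasSupp volume)
    (hFG : ∀ (z : ι → ℂ) (ξ : ℝ), ‖∑ i, z i * F i ξ‖ = ‖∑ i, z i * G i ξ‖) :
    (P.map fun ω i => simpleStochasticIntegral M (F i) ω)
      = P.map fun ω i => simpleStochasticIntegral M (G i) ω := by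
  have hlp : (P.map fun ω => WithLp.toLp 2 fun i => simpleStochasticIntegral M (F i) ω)
      = P.map fun ω => WithLp.toLp 2 fun i => simpleStochasticIntegral M (G i) ω := by
    refine Measure.ext_of_charFun (funext fun z => ?_)
    rw [hM.charFun_toLp_integral hα hF, hM.charFun_toLp_integral hα hG]
    simp only [hFG]
  have := congrArg (Measure.map (WithLp.ofLp (p := 2) (V := ι → ℂ))) hlp
  rwa [Measure.map_map (WithLp.measurable_ofLp 2 _) (hM.measurable_toLp_integral hF),
    Measure.map_map (WithLp.measurable_ofLp 2 _) (hM.measurable_toLp_integral hG)] at this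

lemma measurePreserving_update_integral (hM : IsIsotropicStableRandomMeasure P α M)
    [IsProbabilityMeasure P] (hα : 0 < α) {κ : Type*} [Finite κ] [DecidableEq κ]
    {F : κ → SimpleFunc ℝ ℂ} (hF : ∀ k, (F k).FinMeasSupp volume) {k₀ : κ}
    (hd : ∀ k, k ≠ k₀ → ∀ ξ, F k₀ ξ = 0 ∨ F k ξ = 0) (ζ : Circle) :
    MeasurePreserving (fun y : κ → ℂ => Function.update y k₀ (ζ * y k₀))
      (P.map fun ω k => simpleStochasticIntegral M (F k) ω)
      (P.map fun ω k => simpleStochasticIntegral M (F k) ω) := by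
  have := Fintype.ofFinite κ
  have hrot : Measurable fun y : κ → ℂ => Function.update y k₀ (ζ * y k₀) := by fun_prop
  have hint : Measurable fun ω k => simpleStochasticIntegral M (F k) ω :=
    measurable_pi_lambda _ fun k => hM.measurable_integral (hF k)
  refine ⟨hrot, ?_⟩
  let G : κ → SimpleFunc ℝ ℂ := Function.update F k₀ ((ζ : ℂ) • F k₀)
  have hG (k : κ) : (G k).FinMeasSupp volume := by
    rcases eq_or_ne k k₀ with rfl | hk
    · simpa only [G, Function.update_self] using finMeasSupp_smul (hF k) _
    · simpa only [G, Function.update_of_ne hk] using hF k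
  rw [Measure.map_map hrot hint]
  refine (Measure.map_congr ?_).trans (hM.map_integral_congr hα hG hF fun z ξ => ?_)
  · filter_upwards [hM.integral_smul_ae (hF k₀) ζ] with ω hω
    funext k
    rcases eq_or_ne k k₀ with rfl | hk
    · simp [G, hω]
    · simp [G, hk]
  · by_cases h0 : F k₀ ξ = 0
    · congr! 3 with k
      rcases eq_or_ne k k₀ with rfl | hk
      · simp [G, h0]
      · simp [G, hk]
    · have hzero (k : κ) (hk : k ≠ k₀) : F k ξ = 0 := (hd k hk ξ).resolve_left h0
      rw [Fintype.sum_eq_single k₀ fun k hne => by simp [G, hne, hzero k hne],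
        Fintype.sum_eq_single k₀ fun k hne => by simp [hzero k hne]]
      simp [G, Circle.norm_coe]

lemma iIndepFun_integral (hM : IsIsotropicStableRandomMeasure P α M)
    [IsProbabilityMeasure P] (hα : 0 < α) {ι : Type*} [Finite ι] {F : ι → SimpleFunc ℝ ℂ}
    (hF : ∀ i, (F i).FinMeasSupp volume)
    (hd : ∀ i j, i ≠ j → ∀ ξ, F i ξ = 0 ∨ F j ξ = 0) :
    iIndepFun (fun i => simpleStochasticIntegral M (F i)) P := by
  have := Fintype.ofFinite ι
  have norm_sum_rpow (z : ι → ℂ) (ξ : ℝ) :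
      ‖∑ i, conj (z i) * F i ξ‖ ^ α = ∑ i, ‖F i ξ‖ ^ α * ‖z i‖ ^ α := by
    by_cases h0 : ∀ i, F i ξ = 0
    · simp [h0, hα.ne']
    push Not at h0
    obtain ⟨i, hi⟩ := h0
    have hz (j : ι) (hj : j ≠ i) : F j ξ = 0 := (hd i j hj.symm ξ).resolve_left hi
    rw [Fintype.sum_eq_single i fun j hj => by simp [hz j hj],
      Fintype.sum_eq_single i fun j hj => by simp [hz j hj, hα.ne'], norm_mul, RCLike.norm_conj,
      mul_comm, Real.mul_rpow (norm_nonneg _) (norm_nonneg _)]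
  rw [iIndepFun_iff_charFun_pi fun i => (hM.measurable_integral (hF i)).aemeasurable]
  intro z
  rw [hM.charFun_toLp_integral hα hF]
  simp_rw [hM.charFun_integral hα (hF _), norm_sum_rpow]
  rw [← Complex.exp_sum, ← Complex.ofReal_sum, Finset.sum_neg_distrib,
    integral_finsetSum _ fun i _ =>
      (integrable_norm_rpow_of_finMeasSupp hα (hF i)).mul_const _]
  simp only [integral_mul_const]

end CharFun

end IsIsotropicStableRandomMeasure

section AbsoluteMoment

variable {α : ℝ} {E : Type*} [NormedAddCommGroup E] [InnerProductSpace ℝ E] [MeasurableSpace E]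
  [BorelSpace E] {μ : Measure E} [IsProbabilityMeasure μ]

lemma one_sub_cos_le_two_mul_abs_rpow (hα : 0 ≤ α) (hα2 : α ≤ 2) (y : ℝ) :
    1 - Real.cos y ≤ 2 * |y| ^ α := by
  rcases le_total |y| 1 with h | h
  · have hpow : y ^ 2 ≤ |y| ^ α := by
      rw [← sq_abs, ← Real.rpow_two]
      exact Real.rpow_le_rpow_of_exponent_ge_of_imp (abs_nonneg y) h hα2 (by grind)
    linarith [Real.one_sub_sq_div_two_le_cos (x := y), sq_nonneg y]
  · linarith [Real.neg_one_le_cos y, Real.one_le_rpow h hα]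

lemma tendsto_one_sub_cos_div_rpow (hα2 : α < 2) (y : ℝ) :
    Tendsto (fun t : ℝ => (1 - Real.cos (t * y)) / t ^ α) (𝓝[>] 0) (𝓝 0) := by
  have hlim : Tendsto (fun t : ℝ => t ^ (2 - α) * (y ^ 2 / 2)) (𝓝[>] 0) (𝓝 0) := by
    have h := ((Real.continuousAt_rpow_const 0 (2 - α) (.inr (by linarith))).tendsto.mul_const
      (y ^ 2 / 2)).mono_left (nhdsWithin_le_nhds (s := Set.Ioi 0))
    rwa [Real.zero_rpow (by linarith), zero_mul] at h
  refine squeeze_zero' ?_ ?_ hlim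
  · filter_upwards [self_mem_nhdsWithin] with t ht
    exact div_nonneg (sub_nonneg.2 (Real.cos_le_one _)) (Real.rpow_nonneg (le_of_lt ht) _)
  · filter_upwards [self_mem_nhdsWithin] with t (ht : 0 < t)
    rw [div_le_iff₀ (Real.rpow_pos_of_pos ht _), mul_right_comm, ← Real.rpow_add ht,
      sub_add_cancel, Real.rpow_two]
    linarith [Real.one_sub_sq_div_two_le_cos (x := t * y)]

lemma one_sub_re_charFun_eq_integral (z : E) :
    1 - (charFun μ z).re = ∫ x, (1 - Real.cos (inner ℝ x z)) ∂μ := by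
  have hcos : Integrable (fun x => Real.cos (inner ℝ x z)) μ :=
    .of_bound (by fun_prop) 1 (.of_forall fun x => Real.abs_cos_le_one _)
  have hexp : Integrable (fun x => Complex.exp (inner ℝ x z * Complex.I)) μ :=
    .of_bound (by fun_prop) 1 (.of_forall fun x => (Complex.norm_exp_ofReal_mul_I _).le)
  rw [integral_sub (integrable_const 1) hcos, integral_const, probReal_univ, one_smul,
    charFun_apply, ← RCLike.re_eq_complex_re, ← integral_re hexp]
  simp only [RCLike.re_eq_complex_re, Complex.exp_ofReal_mul_I_re]

lemma tendsto_one_sub_re_charFun_div_rpow (hα : 0 ≤ α) (hα2 : α < 2)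
    (hμ : Integrable (fun x => ‖x‖ ^ α) μ) (v : E) :
    Tendsto (fun t : ℝ => (1 - (charFun μ (t • v)).re) / t ^ α) (𝓝[>] 0) (𝓝 0) := by
  simp_rw [one_sub_re_charFun_eq_integral, ← integral_div, inner_smul_right]
  rw [show 𝓝 (0 : ℝ) = 𝓝 (∫ _ : E, (0 : ℝ) ∂μ) by rw [integral_zero]]
  refine tendsto_integral_filter_of_dominated_convergence (fun x => 2 * ‖v‖ ^ α * ‖x‖ ^ α)
    (.of_forall fun t => by fun_prop) ?_ (hμ.const_mul _)
    (.of_forall fun x => tendsto_one_sub_cos_div_rpow hα2 _)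
  filter_upwards [self_mem_nhdsWithin] with t (ht : 0 < t)
  refine .of_forall fun x => ?_
  have hpow : 0 < t ^ α := Real.rpow_pos_of_pos ht _
  rw [Real.norm_of_nonneg (div_nonneg (sub_nonneg.2 (Real.cos_le_one _)) hpow.le),
    div_le_iff₀ hpow]
  calc 1 - Real.cos (t * inner ℝ x v) ≤ 2 * |t * inner ℝ x v| ^ α :=
        one_sub_cos_le_two_mul_abs_rpow hα hα2.le _
    _ ≤ 2 * (t * (‖x‖ * ‖v‖)) ^ α := by
        rw [abs_mul, abs_of_pos ht]
        gcongr
        exact abs_real_inner_le_norm x v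
    _ = 2 * ‖v‖ ^ α * ‖x‖ ^ α * t ^ α := by
        rw [Real.mul_rpow ht.le (by positivity), Real.mul_rpow (norm_nonneg _) (norm_nonneg _)]
        ring

lemma not_integrable_norm_rpow_of_charFun_eq [Nontrivial E] (hα : 0 < α) (hα2 : α < 2)
    (hμ : ∀ z, charFun μ z = Complex.exp ((-‖z‖ ^ α : ℝ) : ℂ)) :
    ¬ Integrable (fun x => ‖x‖ ^ α) μ := by
  intro hint
  obtain ⟨v, hv⟩ := exists_norm_eq E zero_le_one
  have hslope : Tendsto (fun x : ℝ => (1 - Real.exp (-x)) / x) (𝓝[>] 0) (𝓝 1) := by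
    have h : HasDerivAt (fun x : ℝ => 1 - Real.exp (-x)) 1 0 := by
      simpa using (hasDerivAt_neg (0 : ℝ)).exp.const_sub 1
    simpa [div_eq_inv_mul] using h.tendsto_slope_zero_right
  have hpow : Tendsto (fun t : ℝ => t ^ α) (𝓝[>] 0) (𝓝[>] 0) := by
    refine tendsto_nhdsWithin_iff.2 ⟨?_, ?_⟩
    · have h := (Real.continuousAt_rpow_const 0 α (.inr hα.le)).tendsto
      rw [Real.zero_rpow hα.ne'] at h
      exact h.mono_left nhdsWithin_le_nhds
    · filter_upwards [self_mem_nhdsWithin] with t ht using Real.rpow_pos_of_pos ht _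
  refine zero_ne_one (tendsto_nhds_unique
    (tendsto_one_sub_re_charFun_div_rpow hα.le hα2 hint v) ?_)
  refine (hslope.comp hpow).congr' ?_
  filter_upwards [self_mem_nhdsWithin] with t (ht : 0 < t)
  rw [hμ, ← Complex.ofReal_exp, Complex.ofReal_re, norm_smul, hv, mul_one,
    Real.norm_of_nonneg ht.le, Function.comp_apply]

end AbsoluteMoment

section TailSeries

variable {X : Type*} [MeasurableSpace X] {μ : Measure X}

lemma ofReal_le_tsum_ite_natCast_lt (y : ℝ) :
    ENNReal.ofReal y ≤ ∑' n : ℕ, if (n : ℝ) < y then 1 else 0 := by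
  calc ENNReal.ofReal y ≤ ENNReal.ofReal ⌈y⌉₊ := ENNReal.ofReal_le_ofReal (Nat.le_ceil y)
    _ = ∑ n ∈ Finset.range ⌈y⌉₊, if (n : ℝ) < y then (1 : ℝ≥0∞) else 0 := by
      rw [Finset.sum_congr rfl fun n hn => if_pos (Nat.lt_ceil.1 (Finset.mem_range.1 hn))]
      simp
    _ ≤ ∑' n : ℕ, if (n : ℝ) < y then 1 else 0 := ENNReal.sum_le_tsum _

lemma lintegral_ofReal_le_tsum_measure_natCast_lt {f : X → ℝ} (hf : Measurable f) :
    ∫⁻ x, ENNReal.ofReal (f x) ∂μ ≤ ∑' n : ℕ, μ {x | n < f x} := by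
  have hmeas (n : ℕ) : MeasurableSet {x | n < f x} := measurableSet_lt measurable_const hf
  calc ∫⁻ x, ENNReal.ofReal (f x) ∂μ
      ≤ ∫⁻ x, ∑' n : ℕ, {x | n < f x}.indicator 1 x ∂μ :=
        lintegral_mono fun x => ofReal_le_tsum_ite_natCast_lt (f x)
    _ = ∑' n : ℕ, μ {x | n < f x} := by
      rw [lintegral_tsum fun n => (measurable_one.indicator (hmeas n)).aemeasurable]
      exact tsum_congr fun n => lintegral_indicator_one (hmeas n)

lemma tsum_nat_add_eq_top {f : ℕ → ℝ≥0∞} (hf : ∀ n, f n ≠ ⊤) (h : ∑' n, f n = ⊤) (k : ℕ) :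
    ∑' n, f (n + k) = ⊤ := by
  rw [← ENNReal.summable.sum_add_tsum_nat_add' (k := k)] at h
  exact (ENNReal.add_eq_top.1 h).resolve_left (ENNReal.sum_ne_top.2 fun n _ => hf n)

lemma tsum_measure_mul_natCast_succ_lt_eq_top [IsFiniteMeasure μ] {f : X → ℝ}
    (hf : Measurable f) (hf0 : 0 ≤ f) (hint : ¬ Integrable f μ) {C : ℝ} (hC : 0 < C) :
    ∑' n : ℕ, μ {x | C * (n + 1) < f x} = ⊤ := by
  have htop : ∑' n : ℕ, μ {x | n < f x / C} = ⊤ := by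
    refine top_le_iff.1 (le_of_eq_of_le ?_
      (lintegral_ofReal_le_tsum_measure_natCast_lt (hf.div_const C)))
    by_contra h
    refine hint ?_
    have h' : Integrable (fun x => f x / C) μ :=
      ⟨by fun_prop, by
        rw [hasFiniteIntegral_iff_ofReal (.of_forall fun x => div_nonneg (hf0 x) hC.le)]
        exact lt_of_le_of_ne le_top (Ne.symm h)⟩
    simpa [div_mul_cancel₀ _ hC.ne'] using h'.mul_const C
  have h := tsum_nat_add_eq_top (fun n => measure_ne_top _ _) htop 1
  simpa only [Nat.cast_add, Nat.cast_one, lt_div_iff₀' hC] using h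

lemma tendsto_prod_measure_compl_zero [IsProbabilityMeasure μ] {s : ℕ → Set X}
    (hs : ∀ n, MeasurableSet (s n)) (hsum : ∑' n, μ (s n) = ⊤) :
    Tendsto (fun N => ∏ n ∈ Finset.range N, μ (s n)ᶜ) atTop (𝓝 0) := by
  have hle (N : ℕ) : ∏ n ∈ Finset.range N, μ (s n)ᶜ
      ≤ ENNReal.ofReal (Real.exp (-∑ n ∈ Finset.range N, μ.real (s n))) := by
    rw [← Finset.sum_neg_distrib, Real.exp_sum,
      ENNReal.ofReal_prod_of_nonneg fun _ _ => (Real.exp_pos _).le]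
    refine Finset.prod_le_prod' fun n _ => ?_
    rw [← ofReal_measureReal, probReal_compl_eq_one_sub (hs n)]
    exact ENNReal.ofReal_le_ofReal (Real.one_sub_le_exp_neg _)
  have hdiv : Tendsto (fun N => ∑ n ∈ Finset.range N, μ.real (s n)) atTop atTop := by
    refine (not_summable_iff_tendsto_nat_atTop_of_nonneg fun n => measureReal_nonneg).1
      fun h => h.tsum_ofReal_ne_top ?_
    rw [← hsum]
    exact tsum_congr fun n => ofReal_measureReal
  refine tendsto_of_tendsto_of_tendsto_of_le_of_le tendsto_const_nhds ?_ (fun _ => zero_le) hle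
  rw [← ENNReal.ofReal_zero]
  exact ENNReal.tendsto_ofReal
    (Real.tendsto_exp_atBot.comp (tendsto_neg_atTop_atBot.comp hdiv))

end TailSeries

section LpNorm

variable {X E : Type*} [MeasurableSpace X] {μ : Measure X} [NormedAddCommGroup E] {p : ℝ≥0∞}

lemma lpNorm_indicator_eq_lpNorm_restrict {f : X → E} (hf : AEStronglyMeasurable f μ) {B : Set X}
    (hB : MeasurableSet B) : lpNorm (B.indicator f) p μ = lpNorm f p (μ.restrict B) := by
  rw [← toReal_eLpNorm (hf.indicator hB), ← toReal_eLpNorm hf.restrict,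
    eLpNorm_indicator_eq_eLpNorm_restrict hB]

lemma toReal_lpAddConst_pos (p : ℝ≥0∞) : 0 < p.LpAddConst.toReal := by
  refine ENNReal.toReal_pos ?_ (ENNReal.LpAddConst_lt_top p).ne
  unfold ENNReal.LpAddConst
  split_ifs <;> simp

lemma eventually_lpNorm_le_mul_lpNorm {ι : Type*} {l : Filter ι} {f : X → E} {s : ι → X → E}
    (hf : MemLp f p μ) (hs : ∀ n, MemLp (s n) p μ)
    (hlim : Tendsto (fun n => eLpNorm (s n - f) p μ) l (𝓝 0)) :
    ∀ᶠ n in l, lpNorm f p μ ≤ 2 * p.LpAddConst.toReal * lpNorm (s n) p μ := by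
  set c := p.LpAddConst.toReal
  have hc : 0 < c := toReal_lpAddConst_pos p
  have triangle (n : ι) : lpNorm f p μ ≤ c * (lpNorm (s n) p μ + lpNorm (s n - f) p μ) := by
    have hsub := (hs n).sub hf
    have h := eLpNorm_sub_le' (hs n).1 hsub.1 p
    rw [sub_sub_cancel] at h
    rw [← toReal_eLpNorm hf.1, ← toReal_eLpNorm (hs n).1, ← toReal_eLpNorm hsub.1,
      ← ENNReal.toReal_add (hs n).2.ne hsub.2.ne, ← ENNReal.toReal_mul]
    exact ENNReal.toReal_mono (ENNReal.mul_ne_top (ENNReal.LpAddConst_lt_top p).ne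
      (ENNReal.add_ne_top.2 ⟨(hs n).2.ne, hsub.2.ne⟩)) h
  have hlim' : Tendsto (fun n => lpNorm (s n - f) p μ) l (𝓝 0) := by
    simp_rw [← toReal_eLpNorm ((hs _).sub hf).1]
    simpa [Function.comp_def] using (ENNReal.tendsto_toReal ENNReal.zero_ne_top).comp hlim
  rcases (lpNorm_nonneg (f := f) (p := p) (μ := μ)).eq_or_lt with h0 | hpos
  · rw [← h0]
    exact .of_forall fun n => by positivity [lpNorm_nonneg (f := s n) (p := p) (μ := μ)]
  · filter_upwards [hlim'.eventually_le_const (show 0 < lpNorm f p μ / (2 * c) by positivity)]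
      with n hn
    have h := (triangle n).trans (mul_le_mul_of_nonneg_left (add_le_add_right hn _) hc.le)
    have hcancel : c * (lpNorm f p μ / (2 * c)) = lpNorm f p μ / 2 := by field_simp
    linarith

end LpNorm

lemma measure_forall_abs_re_le_of_tendstoInMeasure {Ω ι κ : Type*} [MeasurableSpace Ω]
    {P : Measure Ω} [Finite ι] {l : Filter κ} [l.NeBot] {V : ι → κ → Ω → ℂ} {Y : ι → Ω → ℂ}
    (hV : ∀ i, TendstoInMeasure P (V i) l (Y i)) {b b' : ι → ℝ} (hb : ∀ i, b i < b' i) {c : ℝ≥0∞}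
    (hc : ∀ᶠ n in l, P {ω | ∀ i, |(V i n ω).re| ≤ b' i} ≤ c) :
    P {ω | ∀ i, |(Y i ω).re| ≤ b i} ≤ c := by
  have := Fintype.ofFinite ι
  have hlim : Tendsto (fun n => c + ∑ i, P {ω | b' i - b i ≤ ‖V i n ω - Y i ω‖}) l (𝓝 c) := by
    simpa using tendsto_const_nhds.add (tendsto_finsetSum Finset.univ fun i _ =>
      tendstoInMeasure_iff_norm.1 (hV i) _ (sub_pos.2 (hb i)))
  refine ge_of_tendsto hlim ?_
  filter_upwards [hc] with n hn
  have hsub : {ω | ∀ i, |(Y i ω).re| ≤ b i} ⊆ {ω | ∀ i, |(V i n ω).re| ≤ b' i} ∪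
      ⋃ i, {ω | b' i - b i ≤ ‖V i n ω - Y i ω‖} := by
    intro ω hω
    by_cases hfar : ∃ i, b' i - b i ≤ ‖V i n ω - Y i ω‖
    · exact .inr (Set.mem_iUnion.2 hfar)
    · push Not at hfar
      refine .inl fun i => ?_
      have hre := (Complex.abs_re_le_norm (V i n ω - Y i ω)).trans (hfar i).le
      rw [Complex.sub_re] at hre
      linarith [hω i, abs_sub_abs_le_abs_sub (V i n ω).re (Y i ω).re]
  exact (measure_mono hsub).trans ((measure_union_le _ _).trans
    (add_le_add hn (measure_iUnion_fintype_le _ _)))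

lemma tendstoInMeasure_sub {Ω E κ : Type*} [MeasurableSpace Ω] {P : Measure Ω}
    [SeminormedAddCommGroup E] {l : Filter κ} {f g : κ → Ω → E} {f' g' : Ω → E}
    (hf : TendstoInMeasure P f l f') (hg : TendstoInMeasure P g l g') :
    TendstoInMeasure P (f - g) l (f' - g') := by
  rw [tendstoInMeasure_iff_norm] at hf hg ⊢
  intro ε hε
  have hlim := (hf _ (half_pos hε)).add (hg _ (half_pos hε))
  rw [add_zero] at hlim
  refine tendsto_of_tendsto_of_tendsto_of_le_of_le tendsto_const_nhds hlim (fun _ => zero_le)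
    fun n => (measure_mono fun ω hω => ?_).trans (measure_union_le _ _)
  by_contra h
  rw [Set.mem_union, not_or, Set.notMem_ofPred_iff, Set.notMem_ofPred_iff, not_le, not_le] at h
  have hnorm : ε ≤ ‖f n ω - g n ω - (f' ω - g' ω)‖ := hω
  rw [sub_sub_sub_comm] at hnorm
  linarith [norm_sub_le (f n ω - f' ω) (g n ω - g' ω)]

lemma restrict_eq_zero_or {X E : Type*} [MeasurableSpace X] [Zero E] {A B : Set X}
    (hA : MeasurableSet A) (hB : MeasurableSet B) (hAB : Disjoint A B) (f g : SimpleFunc X E)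
    (ξ : X) : f.restrict A ξ = 0 ∨ g.restrict B ξ = 0 := by
  rw [SimpleFunc.restrict_apply _ hA, SimpleFunc.restrict_apply _ hB]
  by_cases hξ : ξ ∈ A
  · exact .inr (Set.indicator_of_notMem (Set.disjoint_left.1 hAB hξ) _)
  · exact .inl (Set.indicator_of_notMem hξ _)

section SmallBall

variable {Ω : Type*} [MeasurableSpace Ω] {P : Measure Ω} {α : ℝ} {M : Set ℝ → Ω → ℂ}

lemma IsStochasticIntegral.sub (hM : IsIsotropicStableRandomMeasure P α M) {f g : ℝ → ℂ}
    {Y Z : Ω → ℂ} (hY : IsStochasticIntegral P α M f Y) (hZ : IsStochasticIntegral P α M g Z) :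
    IsStochasticIntegral P α M (f - g) (Y - Z) := by
  obtain ⟨hf, s, hs, hsf, hsY⟩ := hY
  obtain ⟨hg, r, hr, hrg, hrZ⟩ := hZ
  refine ⟨hf.sub hg, fun n => s n + (-1 : ℂ) • r n,
    fun n => (hs n).add (finMeasSupp_smul (hr n) _), ?_, ?_⟩
  · have hlim := ENNReal.Tendsto.const_mul (a := (ENNReal.ofReal α).LpAddConst) (hsf.add hrg)
      (.inr (ENNReal.LpAddConst_lt_top _).ne)
    rw [add_zero, mul_zero] at hlim
    refine tendsto_of_tendsto_of_tendsto_of_le_of_le tendsto_const_nhds hlim (fun _ => zero_le)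
      fun n => ?_
    have hdiff : (fun ξ => (s n + (-1 : ℂ) • r n) ξ - (f - g) ξ) = (⇑(s n) - f) - (⇑(r n) - g) := by
      funext ξ
      simp only [SimpleFunc.coe_add, SimpleFunc.coe_smul, Pi.add_apply, Pi.smul_apply,
        Pi.sub_apply, smul_eq_mul]
      ring
    exact (congrArg (eLpNorm · _ _) hdiff).trans_le (eLpNorm_sub_le'
      ((s n).aestronglyMeasurable.sub hf.1) ((r n).aestronglyMeasurable.sub hg.1) _)
  · refine (tendstoInMeasure_sub hsY hrZ).congr' (.of_forall fun n => ?_) .rfl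
    filter_upwards [hM.integral_add_ae (hs n) (finMeasSupp_smul (hr n) (-1 : ℂ)),
      hM.integral_smul_ae (hr n) (-1)] with ω hadd hsmul
    rw [hadd, hsmul, neg_one_mul, ← sub_eq_add_neg, Pi.sub_apply, Pi.sub_apply]

namespace IsIsotropicStableRandomMeasure

variable [IsProbabilityMeasure P]

lemma map_integral_eq_map_lpNorm_mul (hM : IsIsotropicStableRandomMeasure P α M) (hα : 0 < α)
    {f : SimpleFunc ℝ ℂ} (hf : f.FinMeasSupp volume) :
    P.map (simpleStochasticIntegral M f)
      = P.map fun ω => (lpNorm f (ENNReal.ofReal α) volume : ℂ) * M (Set.Icc 0 1) ω := by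
  have hZ : Measurable (M (Set.Icc 0 1)) := hM.measurable _ measurableSet_Icc (by simp)
  have := Measure.isProbabilityMeasure_map (hM.measurable_integral hf).aemeasurable (μ := P)
  have := Measure.isProbabilityMeasure_map (μ := P)
    (hZ.const_mul (lpNorm f (ENNReal.ofReal α) volume : ℂ)).aemeasurable
  refine Measure.ext_of_charFun (funext fun z => ?_)
  have hint : 0 ≤ ∫ ξ, ‖f ξ‖ ^ α := integral_nonneg fun ξ => by positivity
  rw [hM.charFun_integral hα hf, charFun_map_const_mul hZ.aemeasurable,
    hM.charFun_eq _ measurableSet_Icc (by simp), norm_mul, RCLike.norm_conj, Complex.norm_real,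
    Real.norm_of_nonneg lpNorm_nonneg, Real.mul_rpow lpNorm_nonneg (norm_nonneg _),
    lpNorm_eq_integral_norm_rpow_toReal (by simpa using hα) ENNReal.ofReal_ne_top
      f.aestronglyMeasurable, ENNReal.toReal_ofReal hα.le, Real.rpow_inv_rpow hint hα.ne',
    Real.volume_Icc, sub_zero, ENNReal.toReal_ofReal zero_le_one, one_mul]

lemma measure_norm_integral_le (hM : IsIsotropicStableRandomMeasure P α M) (hα : 0 < α)
    {f : SimpleFunc ℝ ℂ} (hf : f.FinMeasSupp volume) (t : ℝ) :
    P {ω | ‖simpleStochasticIntegral M f ω‖ ≤ t}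
      = P {ω | lpNorm f (ENNReal.ofReal α) volume * ‖M (Set.Icc 0 1) ω‖ ≤ t} := by
  have hball : MeasurableSet {w : ℂ | ‖w‖ ≤ t} := measurableSet_le measurable_norm measurable_const
  have hZ : Measurable (M (Set.Icc 0 1)) := hM.measurable _ measurableSet_Icc (by simp)
  have h := congrArg (fun μ : Measure ℂ => μ {w | ‖w‖ ≤ t})
    (hM.map_integral_eq_map_lpNorm_mul hα hf)
  beta_reduce at h
  rw [Measure.map_apply (hM.measurable_integral hf) hball,
    Measure.map_apply (hZ.const_mul _) hball] at h
  simpa only [Set.preimage_ofPred_eq, norm_mul, Complex.norm_real,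
    Real.norm_of_nonneg lpNorm_nonneg] using h

variable {ι : Type*} [Fintype ι] {B : ι → Set ℝ}

lemma measure_forall_norm_integral_restrict_le (hM : IsIsotropicStableRandomMeasure P α M)
    (hα : 0 < α) {f : ι → SimpleFunc ℝ ℂ} (hf : ∀ i, (f i).FinMeasSupp volume)
    (hB : ∀ i, MeasurableSet (B i)) (hBd : Pairwise (Function.onFun Disjoint B)) (t : ι → ℝ) :
    P {ω | ∀ i, ‖simpleStochasticIntegral M ((f i).restrict (B i)) ω‖ ≤ t i}
      = ∏ i, P {ω | lpNorm (f i) (ENNReal.ofReal α) (volume.restrict (B i))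
          * ‖M (Set.Icc 0 1) ω‖ ≤ t i} := by
  have hindep := hM.iIndepFun_integral hα (fun i => finMeasSupp_restrict (hf i) (hB i))
    fun i j hij => restrict_eq_zero_or (hB i) (hB j) (hBd hij) (f i) (f j)
  have hprod := hindep.measure_inter_preimage_eq_mul Finset.univ (sets := fun i => {w | ‖w‖ ≤ t i})
    fun i _ => measurableSet_le measurable_norm measurable_const
  simp only [Finset.mem_univ, forall_const, Set.preimage_ofPred_eq, Set.iInter_ofPred] at hprod
  rw [hprod]
  refine Finset.prod_congr rfl fun i _ => ?_
  rw [hM.measure_norm_integral_le hα (finMeasSupp_restrict (hf i) (hB i)),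
    SimpleFunc.coe_restrict _ (hB i),
    lpNorm_indicator_eq_lpNorm_restrict (f i).aestronglyMeasurable (hB i)]

lemma measure_forall_abs_re_integral_le [LinearOrder ι] [LocallyFiniteOrderBot ι]
    (hM : IsIsotropicStableRandomMeasure P α M) (hα : 0 < α) {S : Finset Circle} {K : ℝ}
    (hS : S.Nonempty)
    (hK : ∀ (w : ℂ) (r b : ℝ), K * b < ‖w‖ →
      #(S.filter fun ζ : Circle => |(ζ * w).re + r| ≤ b) ≤ 2)
    {f : ι → SimpleFunc ℝ ℂ} (hf : ∀ i, (f i).FinMeasSupp volume)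
    (hB : ∀ i, MeasurableSet (B i)) (hBd : Pairwise (Function.onFun Disjoint B)) (b : ι → ℝ) :
    P {ω | ∀ i, |(simpleStochasticIntegral M (f i) ω).re| ≤ b i} ≤ 2 / #S +
      ∏ i, P {ω | lpNorm (f i) (ENNReal.ofReal α) (volume.restrict (B i)) * ‖M (Set.Icc 0 1) ω‖
        ≤ K * b i} := by
  let W (i : ι) : SimpleFunc ℝ ℂ := (f i).restrict (B i)
  let R (i : ι) : SimpleFunc ℝ ℂ := (f i).restrict (B i)ᶜ
  have hW (i : ι) : (W i).FinMeasSupp volume := finMeasSupp_restrict (hf i) (hB i)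
  have hR (i : ι) : (R i).FinMeasSupp volume := finMeasSupp_restrict (hf i) (hB i).compl
  have hsplit (i : ι) : f i = W i + R i := by
    refine DFunLike.coe_injective ?_
    simp only [W, R, SimpleFunc.coe_add, SimpleFunc.coe_restrict _ (hB i),
      SimpleFunc.coe_restrict _ (hB i).compl, Set.indicator_self_add_compl]
  rw [← hM.measure_forall_norm_integral_restrict_le hα hf hB hBd]
  calc P {ω | ∀ i, |(simpleStochasticIntegral M (f i) ω).re| ≤ b i}
      ≤ P {ω | ∀ i, |(simpleStochasticIntegral M (W i) ω
          + simpleStochasticIntegral M (R i) ω).re| ≤ b i} := by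
        refine measure_mono_ae ?_
        filter_upwards [ae_all_iff.2 fun i => hM.integral_add_ae (hW i) (hR i)] with ω hω h i
        rw [← hω, ← hsplit]
        exact h i
    _ ≤ 2 / #S + P {ω | ∀ i, ‖simpleStochasticIntegral M (W i) ω‖ ≤ K * b i} := by
        refine measure_forall_abs_re_le_of_measurePreserving_update hS hK
          (fun i => hM.measurable_integral (hW i)) (fun i => hM.measurable_integral (hR i)) b
          fun j ζ _ => ?_
        have hVF : (fun ω (o : Option ι) => o.elim (simpleStochasticIntegral M (R j) ω)
              fun i => simpleStochasticIntegral M (W i) ω)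
            = fun ω o => simpleStochasticIntegral M (o.elim (R j) W) ω := by
          funext ω o
          cases o <;> rfl
        rw [hVF]
        refine hM.measurePreserving_update_integral hα (Option.rec (hR j) hW) ?_ ζ
        rintro (_ | i) hij
        · exact restrict_eq_zero_or (hB j) (hB j).compl disjoint_compl_right _ _
        · exact restrict_eq_zero_or (hB j) (hB i) (hBd fun h => hij (h ▸ rfl)) _ _

end IsIsotropicStableRandomMeasure

end SmallBall

section LimitPassage

variable {Ω : Type*} [MeasurableSpace Ω] {P : Measure Ω} [IsProbabilityMeasure P] {α : ℝ}
  {M : Set ℝ → Ω → ℂ}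

-- In the constant, `2 * LpAddConst` comes from the quasi-triangle inequality when `f i` is replaced
-- by a simple function (`α` may be less than `1`), the other `2` from enlarging `b i` to `2 * b i`.
lemma measure_forall_abs_re_le_of_isStochasticIntegral {ι : Type*} [Fintype ι] [LinearOrder ι]
    [LocallyFiniteOrderBot ι] (hM : IsIsotropicStableRandomMeasure P α M) (hα : 0 < α)
    {S : Finset Circle} {K : ℝ} (hS : S.Nonempty)
    (hK : ∀ (w : ℂ) (r b : ℝ), K * b < ‖w‖ →
      #(S.filter fun ζ : Circle => |(ζ * w).re + r| ≤ b) ≤ 2)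
    {f : ι → ℝ → ℂ} {Y : ι → Ω → ℂ} (hY : ∀ i, IsStochasticIntegral P α M (f i) (Y i))
    {B : ι → Set ℝ} (hB : ∀ i, MeasurableSet (B i)) (hBd : Pairwise (Function.onFun Disjoint B))
    {b : ι → ℝ} (hb : ∀ i, 0 < b i) :
    P {ω | ∀ i, |(Y i ω).re| ≤ b i} ≤ 2 / #S +
      ∏ i, P {ω | lpNorm (f i) (ENNReal.ofReal α) (volume.restrict (B i)) * ‖M (Set.Icc 0 1) ω‖
        ≤ 4 * (ENNReal.ofReal α).LpAddConst.toReal * K * b i} := by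
  set c := (ENNReal.ofReal α).LpAddConst.toReal
  have hc : 0 < c := toReal_lpAddConst_pos _
  choose hf s hs hsf hsY using hY
  have hnorm : ∀ᶠ n in atTop, ∀ i, lpNorm (f i) (ENNReal.ofReal α) (volume.restrict (B i))
      ≤ 2 * c * lpNorm (s i n) (ENNReal.ofReal α) (volume.restrict (B i)) :=
    eventually_all.2 fun i => eventually_lpNorm_le_mul_lpNorm ((hf i).restrict _)
      (fun n => (SimpleFunc.memLp_of_finite_measure_preimage _
        fun y hy => (hs i n).meas_preimage_singleton_ne_zero hy).restrict _)
      (tendsto_of_tendsto_of_tendsto_of_le_of_le tendsto_const_nhds (hsf i) (fun _ => zero_le)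
        fun n => eLpNorm_mono_measure _ Measure.restrict_le_self)
  refine measure_forall_abs_re_le_of_tendstoInMeasure hsY (b' := fun i => 2 * b i)
    (fun i => by linarith [hb i]) ?_
  filter_upwards [hnorm] with n hn
  refine (hM.measure_forall_abs_re_integral_le hα hS hK (fun i => hs i n) hB hBd _).trans ?_
  refine add_le_add_right (Finset.prod_le_prod' fun i _ => measure_mono fun ω hω => ?_) _
  calc lpNorm (f i) (ENNReal.ofReal α) (volume.restrict (B i)) * ‖M (Set.Icc 0 1) ω‖
      ≤ 2 * c * lpNorm (s i n) (ENNReal.ofReal α) (volume.restrict (B i))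
          * ‖M (Set.Icc 0 1) ω‖ := by gcongr; exact hn i
    _ ≤ 2 * c * (K * (2 * b i)) := by
      rw [mul_assoc]
      exact mul_le_mul_of_nonneg_left hω (by positivity)
    _ = 4 * c * K * b i := by ring

lemma measure_forall_abs_re_le_eq_zero (hM : IsIsotropicStableRandomMeasure P α M) (hα : 0 < α)
    {f : ℕ → ℝ → ℂ} {Y : ℕ → Ω → ℂ} (hY : ∀ i, IsStochasticIntegral P α M (f i) (Y i))
    {B : ℕ → Set ℝ} (hB : ∀ i, MeasurableSet (B i)) (hBd : Pairwise (Function.onFun Disjoint B))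
    {b : ℕ → ℝ} (hb : ∀ i, 0 < b i)
    (hsum : ∀ C > 0, ∑' i, P {ω | C * b i <
      lpNorm (f i) (ENNReal.ofReal α) (volume.restrict (B i)) * ‖M (Set.Icc 0 1) ω‖} = ⊤) :
    P {ω | ∀ i, |(Y i ω).re| ≤ b i} = 0 := by
  have le_two_div (m : ℕ) (hm : 0 < m) : P {ω | ∀ i, |(Y i ω).re| ≤ b i} ≤ 2 / m := by
    obtain ⟨S, hS⟩ := exists_finset_circle_card_eq m
    obtain ⟨K, hK0, hK⟩ := exists_pos_forall_card_abs_re_le S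
    set C := 4 * (ENNReal.ofReal α).LpAddConst.toReal * K
    have hC : 0 < C := by positivity [toReal_lpAddConst_pos (ENNReal.ofReal α)]
    let E (i : ℕ) : Set Ω := {ω | C * b i <
      lpNorm (f i) (ENNReal.ofReal α) (volume.restrict (B i)) * ‖M (Set.Icc 0 1) ω‖}
    have hE (i : ℕ) : MeasurableSet (E i) := measurableSet_lt measurable_const
      ((hM.measurable _ measurableSet_Icc (by simp)).norm.const_mul _)
    have hlim := (tendsto_const_nhds (x := 2 / (m : ℝ≥0∞))).add
      (tendsto_prod_measure_compl_zero hE (hsum C hC))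
    rw [add_zero] at hlim
    refine ge_of_tendsto' hlim fun N => ?_
    have hN := measure_forall_abs_re_le_of_isStochasticIntegral hM hα (ι := Fin N)
      (Finset.card_pos.1 (hS ▸ hm)) hK (fun i => hY i) (fun i => hB i)
      (hBd.comp_of_injective Fin.val_injective) (fun i => hb i)
    rw [hS] at hN
    have hsub : {ω | ∀ i, |(Y i ω).re| ≤ b i} ⊆ {ω | ∀ i : Fin N, |(Y i ω).re| ≤ b i} :=
      fun ω hω i => hω i
    refine (measure_mono hsub).trans (hN.trans_eq ?_)
    rw [← Fin.prod_univ_eq_prod_range (fun i => P (E i)ᶜ)]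
    simp only [E, Set.compl_ofPred, not_lt, C]
  have hlim : Tendsto (fun m : ℕ => 2 / (m : ℝ≥0∞)) atTop (𝓝 0) := by
    simpa [div_eq_mul_inv] using
      ENNReal.Tendsto.const_mul (a := 2) ENNReal.tendsto_inv_nat_nhds_zero (by simp)
  exact le_zero_iff.1 (ge_of_tendsto hlim ((eventually_gt_atTop 0).mono le_two_div))

theorem ae_frequently_lt_abs_re (hM : IsIsotropicStableRandomMeasure P α M) (hα : 0 < α)
    {f : ℕ → ℝ → ℂ} {Y : ℕ → Ω → ℂ} (hY : ∀ i, IsStochasticIntegral P α M (f i) (Y i))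
    {B : ℕ → Set ℝ} (hB : ∀ i, MeasurableSet (B i)) (hBd : Pairwise (Function.onFun Disjoint B))
    {b : ℕ → ℝ} (hb : ∀ i, 0 < b i)
    (hsum : ∀ C > 0, ∑' i, P {ω | C * b i <
      lpNorm (f i) (ENNReal.ofReal α) (volume.restrict (B i)) * ‖M (Set.Icc 0 1) ω‖} = ⊤) :
    ∀ᵐ ω ∂P, ∃ᶠ i in atTop, b i < |(Y i ω).re| := by
  simp only [frequently_atTop', gt_iff_lt]
  refine ae_all_iff.2 fun k => ?_
  have htail := measure_forall_abs_re_le_eq_zero hM hα (fun i => hY (i + (k + 1)))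
    (fun i => hB (i + (k + 1))) (hBd.comp_of_injective (add_left_injective (k + 1)))
    (fun i => hb (i + (k + 1)))
    fun C hC => tsum_nat_add_eq_top (fun _ => measure_ne_top _ _) (hsum C hC) (k + 1)
  filter_upwards [measure_eq_zero_iff_ae_notMem.1 htail] with ω hω
  simp only [not_forall, not_le] at hω
  obtain ⟨i, hi⟩ := hω
  exact ⟨_, by lia, hi⟩

end LimitPassage

section Kernel

lemma mul_rpow_measureReal_le_lpNorm_restrict {X E : Type*} [MeasurableSpace X] {μ : Measure X}
    [NormedAddCommGroup E] {p : ℝ≥0∞} (hp0 : p ≠ 0) (hp : p ≠ ⊤) {f : X → E} {B : Set X}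
    (hf : MemLp f p (μ.restrict B)) (hB : MeasurableSet B) {c : ℝ} (hc : 0 ≤ c)
    (hcf : ∀ x ∈ B, c ≤ ‖f x‖) :
    c * μ.real B ^ p.toReal⁻¹ ≤ lpNorm f p (μ.restrict B) := by
  have h : eLpNorm (fun _ => c) p (μ.restrict B) ≤ eLpNorm f p (μ.restrict B) :=
    eLpNorm_mono_ae ((ae_restrict_iff' hB).2 (.of_forall fun x hx => by
      simpa only [Real.norm_of_nonneg hc] using hcf x hx))
  have hle := ENNReal.toReal_mono hf.2.ne h
  rwa [toReal_eLpNorm hf.1, toReal_eLpNorm aestronglyMeasurable_const, lpNorm_const' hp0 hp,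
    Real.norm_of_nonneg hc, measureReal_restrict_apply_univ] at hle

lemma half_le_norm_exp_I_mul_sub_one {x : ℝ} (h1 : 1 ≤ x) (h2 : x ≤ 2) :
    1 / 2 ≤ ‖Complex.exp (Complex.I * x) - 1‖ := by
  have hpi := Real.pi_gt_three
  have hjordan : 2 / Real.pi * (x / 2) ≤ Real.sin (x / 2) :=
    Real.mul_le_sin (by linarith) (by linarith)
  have hquarter : 1 / 4 ≤ 2 / Real.pi * (x / 2) := by
    rw [div_mul_div_cancel₀' two_ne_zero, div_le_div_iff₀ (by norm_num) Real.pi_pos]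
    linarith [Real.pi_lt_four]
  rw [Complex.norm_exp_I_mul_ofReal_sub_one]
  linarith [Real.le_norm_self (2 * Real.sin (x / 2))]

lemma norm_hfsmKernel_sub (H α s t ξ : ℝ) :
    ‖hfsmKernel H α t ξ - hfsmKernel H α s ξ‖
      = ‖Complex.exp (Complex.I * ((t - s) * ξ : ℝ)) - 1‖ / |ξ| ^ (H + 1 / α) := by
  have hphase : Complex.exp (Complex.I * t * ξ) - Complex.exp (Complex.I * s * ξ)
      = Complex.exp ((s * ξ : ℝ) * Complex.I)
        * (Complex.exp (Complex.I * ((t - s) * ξ : ℝ)) - 1) := by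
    rw [mul_sub, mul_one, ← Complex.exp_add]
    push_cast
    ring_nf
  rw [hfsmKernel, hfsmKernel, ← sub_div, sub_sub_sub_cancel_right, hphase, norm_div, norm_mul,
    Complex.norm_exp_ofReal_mul_I, one_mul, Complex.norm_real,
    Real.norm_of_nonneg (Real.rpow_nonneg (abs_nonneg ξ) _)]

lemma le_lpNorm_hfsmKernel_sub {H α u q : ℝ} (hα : 0 < α) (hH : 0 ≤ H + 1 / α) (hq : 0 < q)
    (hf : MemLp (hfsmKernel H α (u + q⁻¹) - hfsmKernel H α u) (ENNReal.ofReal α) volume) :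
    1 / 2 / 2 ^ (H + 1 / α) * q⁻¹ ^ H
      ≤ lpNorm (hfsmKernel H α (u + q⁻¹) - hfsmKernel H α u) (ENNReal.ofReal α)
        (volume.restrict (Set.Ico q (2 * q))) := by
  have hle := mul_rpow_measureReal_le_lpNorm_restrict (by simpa using hα) ENNReal.ofReal_ne_top
    (hf.restrict _) measurableSet_Ico (c := 1 / 2 / (2 * q) ^ (H + 1 / α)) (by positivity)
    fun ξ hξ => by
      have hξ0 : 0 < ξ := hq.trans_le hξ.1
      rw [Pi.sub_apply, norm_hfsmKernel_sub, add_sub_cancel_left, abs_of_pos hξ0]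
      gcongr
      · refine half_le_norm_exp_I_mul_sub_one ?_ ?_
        · rw [inv_mul_eq_div, one_le_div hq]
          exact hξ.1
        · rw [inv_mul_eq_div, div_le_iff₀ hq]
          exact hξ.2.le
      · exact hξ.2.le
  refine le_of_eq_of_le ?_ hle
  rw [Real.volume_real_Ico_of_le (by linarith), ENNReal.toReal_ofReal hα.le,
    Real.mul_rpow zero_le_two hq.le, Real.rpow_add hq, Real.inv_rpow hq.le, ← one_div α,
    show 2 * q - q = q by ring]
  field_simp

lemma log_one_add_two_pow_le (j : ℕ) : Real.log (1 + 2 ^ j) ≤ j + 1 := by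
  have hpow : (1 : ℝ) + 2 ^ j ≤ 2 ^ (j + 1) := by
    rw [pow_succ]
    linarith [one_le_pow₀ (M₀ := ℝ) one_le_two (n := j)]
  calc Real.log (1 + 2 ^ j) ≤ Real.log (2 ^ (j + 1)) := Real.log_le_log (by positivity) hpow
    _ = (j + 1) * Real.log 2 := by rw [Real.log_pow, Nat.cast_succ]
    _ ≤ j + 1 := mul_le_of_le_one_right (by positivity) (by linarith [Real.log_two_lt_d9])

end Kernel

section Increments

variable {Ω : Type*} [MeasurableSpace Ω] {P : Measure Ω} [IsProbabilityMeasure P] {H α : ℝ}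
  {M : Set ℝ → Ω → ℂ}

lemma IsIsotropicStableRandomMeasure.tsum_measure_mul_rpow_lt_norm_eq_top
    (hM : IsIsotropicStableRandomMeasure P α M) (hα : 0 < α) (hα2 : α < 2) {C : ℝ} (hC : 0 < C) :
    ∑' j : ℕ, P {ω | C * (j + 1) ^ (1 / α) < ‖M (Set.Icc 0 1) ω‖} = ⊤ := by
  have hZ : Measurable (M (Set.Icc 0 1)) := hM.measurable _ measurableSet_Icc (by simp)
  have hint : ¬ Integrable (fun ω => ‖M (Set.Icc 0 1) ω‖ ^ α) P := fun h => by
    have := Measure.isProbabilityMeasure_map hZ.aemeasurable (μ := P)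
    refine not_integrable_norm_rpow_of_charFun_eq (μ := P.map (M (Set.Icc 0 1))) hα hα2
      (fun z => ?_) ((integrable_map_measure
      (measurable_norm.pow_const α).aestronglyMeasurable hZ.aemeasurable).2 h)
    rw [hM.charFun_eq _ measurableSet_Icc (by simp)]
    simp
  have htop := tsum_measure_mul_natCast_succ_lt_eq_top (by fun_prop) (fun ω => by positivity) hint
    (Real.rpow_pos_of_pos hC α)
  refine top_le_iff.1 (htop.ge.trans (ENNReal.tsum_le_tsum fun j => measure_mono fun ω hω => ?_))
  have hroot : C * (j + 1 : ℝ) ^ (1 / α) = (C ^ α * (j + 1)) ^ (1 / α) := by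
    rw [Real.mul_rpow (by positivity) (by positivity), one_div, Real.rpow_rpow_inv hC.le hα.ne']
  rw [Set.mem_ofPred_eq, hroot, one_div,
    Real.rpow_inv_lt_iff_of_pos (by positivity) (norm_nonneg _) hα]
  exact hω

theorem ae_frequently_lt_abs_re_hfsm_increment (hM : IsIsotropicStableRandomMeasure P α M)
    (hH : 0 ≤ H + 1 / α) (hα : 0 < α) (hα2 : α < 2) {Y : ℝ → Ω → ℂ}
    (hY : ∀ t, IsStochasticIntegral P α M (hfsmKernel H α t) (Y t)) (u : ℝ) {A : ℝ} (hA : 0 < A) :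
    ∀ᵐ ω ∂P, ∃ᶠ j : ℕ in atTop,
      A * (((2 : ℝ) ^ j)⁻¹ ^ H * Real.log (1 + 2 ^ j) ^ (1 / α))
        < |(Y (u + ((2 : ℝ) ^ j)⁻¹) ω - Y u ω).re| := by
  have hlog (j : ℕ) : 0 < Real.log (1 + 2 ^ j) :=
    Real.log_pos (lt_add_of_pos_right _ (by positivity))
  have hincr (j : ℕ) := (hY (u + ((2 : ℝ) ^ j)⁻¹)).sub hM (hY u)
  refine ae_frequently_lt_abs_re hM hα hincr (B := fun j => Set.Ico (2 ^ j) (2 * 2 ^ j))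
    (fun _ => measurableSet_Ico) ?_ (fun j => by positivity [hlog j]) fun C hC => ?_
  · simp only [← pow_succ']
    exact (pow_right_mono₀ one_le_two).pairwise_disjoint_on_Ico_succ
  set κ : ℝ := 1 / 2 / 2 ^ (H + 1 / α)
  have hκ : 0 < κ := by positivity
  refine top_le_iff.1 ((hM.tsum_measure_mul_rpow_lt_norm_eq_top hα hα2
    (div_pos (mul_pos hC hA) hκ)).ge.trans (ENNReal.tsum_le_tsum fun j =>
      measure_mono (Set.ofPred_subset_ofPred.2 fun ω hω => ?_)))
  calc C * (A * (((2 : ℝ) ^ j)⁻¹ ^ H * Real.log (1 + 2 ^ j) ^ (1 / α)))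
      ≤ C * (A * (((2 : ℝ) ^ j)⁻¹ ^ H * (j + 1) ^ (1 / α))) := by
        gcongr
        exacts [(hlog j).le, log_one_add_two_pow_le j]
    _ = κ * ((2 : ℝ) ^ j)⁻¹ ^ H * (C * A / κ * (j + 1) ^ (1 / α)) := by field_simp
    _ < κ * ((2 : ℝ) ^ j)⁻¹ ^ H * ‖M (Set.Icc 0 1) ω‖ := by gcongr
    _ ≤ lpNorm (hfsmKernel H α (u + ((2 : ℝ) ^ j)⁻¹) - hfsmKernel H α u) (ENNReal.ofReal α)
          (volume.restrict (Set.Ico (2 ^ j) (2 * 2 ^ j))) * ‖M (Set.Icc 0 1) ω‖ := by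
        gcongr
        exact le_lpNorm_hfsmKernel_sub hα hH (by positivity) (hincr j).1

theorem mainTheorem2_general {X : ℝ → Ω → ℝ} (hH : 0 < H) (hα : 0 < α) (hα2 : α < 2)
    (hM : IsIsotropicStableRandomMeasure P α M)
    (hX : ∀ t, ∃ Y : Ω → ℂ, IsStochasticIntegral P α M (hfsmKernel H α t) Y ∧
      ∀ᵐ ω ∂P, X t ω = (Y ω).re) (u : ℝ) :
    ∀ᵐ ω ∂P, limsup (fun t => ENNReal.ofReal
      (|X u ω - X t ω| / (|u - t| ^ H * Real.log (1 + |u - t|⁻¹) ^ (1 / α)))) (𝓝[>] u) = ⊤ := by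
  choose Y hY hXY using hX
  have hdyadic : Tendsto (fun j : ℕ => u + ((2 : ℝ) ^ j)⁻¹) atTop (𝓝[>] u) := by
    refine tendsto_nhdsWithin_iff.2 ⟨?_, .of_forall fun j =>
      Set.mem_Ioi.2 (lt_add_of_pos_right u (by positivity))⟩
    have hinv : Tendsto (fun j : ℕ => ((2 : ℝ) ^ j)⁻¹) atTop (𝓝 0) :=
      tendsto_inv_atTop_zero.comp (tendsto_pow_atTop_atTop_of_one_lt one_lt_two)
    simpa only [add_zero] using hinv.const_add u
  have hfreq : ∀ᵐ ω ∂P, ∀ A : ℕ, ∃ᶠ j : ℕ in atTop,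
      (A + 1) * (((2 : ℝ) ^ j)⁻¹ ^ H * Real.log (1 + 2 ^ j) ^ (1 / α))
        < |(Y (u + ((2 : ℝ) ^ j)⁻¹) ω - Y u ω).re| :=
    ae_all_iff.2 fun A => ae_frequently_lt_abs_re_hfsm_increment hM (by positivity) hα hα2 hY u
      (by positivity)
  filter_upwards [hfreq, hXY u, ae_all_iff.2 fun j : ℕ => hXY (u + ((2 : ℝ) ^ j)⁻¹)]
    with ω hω hu ht
  refine ENNReal.eq_top_of_forall_nnreal_le fun r => ?_
  obtain ⟨A, hA⟩ := exists_nat_ge r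
  refine le_limsup_of_frequently_le' (hdyadic.frequently ((hω A).mono fun j hj => ?_))
  have hlog : 0 < Real.log (1 + 2 ^ j) :=
    Real.log_pos (lt_add_of_pos_right _ (by positivity))
  have hpos : 0 < ((2 : ℝ) ^ j)⁻¹ := by positivity
  rw [sub_add_cancel_left, abs_neg, abs_of_pos hpos, inv_inv, abs_sub_comm (X u ω), hu, ht,
    ← Complex.sub_re, ← ENNReal.ofReal_coe_nnreal]
  refine ENNReal.ofReal_le_ofReal ((le_div_iff₀ (by positivity)).2 (le_trans ?_ hj.le))
  gcongr
  linarith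

end Increments

theorem mainTheorem2 {Ω : Type*} [MeasurableSpace Ω] (P : Measure Ω) [IsProbabilityMeasure P]
    (H α : ℝ) (hH0 : 0 < H) (hH1 : H < 1) (hα0 : 0 < α) (hα2 : α < 2)
    (M : Set ℝ → Ω → ℂ) (X : ℝ → Ω → ℝ) (hX : IsHFSM P H α M X)
    (u v : ℝ) (huv : u < v) :
    ∀ᵐ ω ∂P,
      (⨆ (s : ℝ) (t : ℝ) (_ : u ≤ s ∧ s < t ∧ t ≤ v),
        ENNReal.ofReal
          (|X s ω - X t ω| / (|s - t| ^ H * (Real.log (1 + |s - t|⁻¹)) ^ (1 / α)))) = ⊤ := by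
  filter_upwards [mainTheorem2_general hH0 hα0 hα2 hX.randomMeasure hX.integral_eq u] with ω hω
  refine eq_top_mono (limsup_le_of_le (h := ?_)) hω
  filter_upwards [Ioc_mem_nhdsGT huv] with t ht
  exact le_iSup₂_of_le u t (le_iSup_of_le ⟨le_rfl, ht.1, ht.2⟩ le_rfl)
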